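/- Let $p>3$ be a prime. For $k\ge 1$ let $H_k^{(r)}=\sum_{j=1}^k j^{-r}$ and $H_k=H_k^{(1)}$; let $q_p(2)=\frac{2^{p-1}-1}{p}$ be the Fermat quotient; let $E_n$ be the Euler numbers, defined by $\frac{2}{e^t+e^{-t}}=\sum_{n\ge 0}E_n\frac{t^n}{n!}$; and let $\Gamma_p:\mathbb{Z}_p\to\mathbb{Z}_p$ be Morita's $p$-adic Gamma function, i.e. the unique continuous function on $\mathbb{Z}_p$ with $\Gamma_p(n)=(-1)^n\prod_{0\le k<n,\ (k,p)=1}k$ for all integers $n>1$. For $a,b\in\mathbb{Q}_p$, write $a\equiv b\pmod{p^2}$ if $a-b\in p^2\mathbb{Z}_p$. Then $$\sum_{k=1}^{p-1}\binom{2k}{k}^3\frac{H_k}{64^k}\equiv\begin{cases}\Gamma_p\left(\frac14\right)^4\left(2q_p(2)-p\,q_p(2)^2\right)&\text{if } p\equiv 1\pmod 4,\\[1mm] -\frac{p}{12}\,\Gamma_p\left(\frac14\right)^4&\text{if } p\equiv 3\pmod 4\end{cases}\pmod{p^2}$$ and $$\sum_{k=1}^{p-1}\binom{2k}{k}^3\frac{H_k^{(2)}}{64^k}\equiv\begin{cases}-\Gamma_p\left(\frac14\right)^4\left(4E_{p-3}-2E_{2p-4}\right)&\text{if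 } p\equiv 1\pmod 4,\\[1mm] -\frac14\,\Gamma_p\left(\frac14\right)^4&\text{if } p\equiv 3\pmod 4\end{cases}\pmod{p^2}.$$ -/

import Mathlib

open Filter Topology

/-- The generalized harmonic number `H_k^{(r)} = ∑_{j=1}^k 1 / j^r`. -/
def genHarmonic (r k : ℕ) : ℚ := ∑ j ∈ Finset.Icc 1 k, 1 / (j : ℚ) ^ r

/-- The Fermat quotient `q_p(a) = (a^(p-1) - 1) / p`. -/
def fermatQuotient (p a : ℕ) : ℚ := ((a : ℚ) ^ (p - 1) - 1) / p

/-- The Euler numbers `1, 0, -1, 0, 5, 0, -61, …`, that is,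
`2 / (e^t + e^(-t)) = ∑ E_n t^n / n!` (see `eulerNumber_generating`), through the recurrence
`∑_{k ≤ n, k ≡ n mod 2} C(n,k) E_k = 0` for `n ≥ 1`. -/
def eulerNumber (n : ℕ) : ℤ :=
  if n = 0 then 1
  else -∑ k : Fin n, if Even (n - (k : ℕ)) then (n.choose k : ℤ) * eulerNumber k else 0
termination_by n
decreasing_by exact k.isLt

theorem eulerNumber_recurrence (n : ℕ) :
    ∑ k ∈ Finset.range (n + 1), (if Even (n - k) then (n.choose k : ℤ) * eulerNumber k else 0)
      = if n = 0 then 1 else 0 := by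
  rw [Finset.sum_range_succ]
  by_cases hn : n = 0
  · subst hn
    have h0 : eulerNumber 0 = 1 := by rw [eulerNumber, if_pos rfl]
    simp [h0]
  · have h : eulerNumber n = -∑ k ∈ Finset.range n,
        (if Even (n - k) then (n.choose k : ℤ) * eulerNumber k else 0) := by
      conv_lhs => rw [eulerNumber]
      rw [if_neg hn, Finset.sum_range]
    simp [hn, h]

/-- The exponential generating function of the Euler numbers is `2 / (e^t + e^(-t))`. -/
theorem eulerNumber_generating :
    PowerSeries.mk (fun n => (eulerNumber n : ℚ) / (n.factorial : ℚ))
      * (PowerSeries.exp ℚ + PowerSeries.evalNegHom (PowerSeries.exp ℚ)) = 2 := by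
  ext n
  have h2 : (2 : PowerSeries ℚ) = PowerSeries.C (2 : ℚ) := (map_ofNat PowerSeries.C 2).symm
  rw [PowerSeries.coeff_mul, Finset.Nat.sum_antidiagonal_eq_sum_range_succ_mk, h2,
    PowerSeries.coeff_C]
  have h := congrArg (fun z : ℤ => (2 * (z : ℚ) / (n.factorial : ℚ))) (eulerNumber_recurrence n)
  simp only [Int.cast_sum, Finset.mul_sum, Finset.sum_div] at h
  have hr : (2 * (((if n = 0 then 1 else 0 : ℤ)) : ℚ) / (n.factorial : ℚ))
      = if n = 0 then 2 else 0 := by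
    split_ifs with h0 <;> simp [h0]
  rw [hr] at h
  rw [← h]
  refine Finset.sum_congr rfl fun k hk => ?_
  have hkn : k ≤ n := Nat.lt_succ_iff.mp (Finset.mem_range.mp hk)
  have hc : (n.choose k : ℚ) = n.factorial / (k.factorial * (n - k).factorial) :=
    Nat.cast_choose ℚ hkn
  have hf : (n.factorial : ℚ) ≠ 0 := by exact_mod_cast n.factorial_ne_zero
  have hf1 : (k.factorial : ℚ) ≠ 0 := by exact_mod_cast k.factorial_ne_zero
  have hf2 : ((n - k).factorial : ℚ) ≠ 0 := by exact_mod_cast (n - k).factorial_ne_zero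
  simp only [PowerSeries.coeff_mk, map_add, PowerSeries.coeff_exp, PowerSeries.evalNegHom,
    PowerSeries.coeff_rescale]
  split_ifs with he
  · simp only [he.neg_one_pow, Int.cast_mul, Int.cast_natCast, hc]
    simp
    field_simp
    ring
  · simp [(Nat.not_even_iff_odd.mp he).neg_one_pow]

/-- The sequence `n ↦ (-1)^n ∏_{0 ≤ k < n, (k,p) = 1} k`. -/
def moritaSeq (p n : ℕ) : ℤ :=
  (-1) ^ n * ∏ k ∈ (Finset.range n).filter (fun k => Nat.Coprime k p), (k : ℤ)

/-- Morita's `p`-adic Gamma function (for odd `p`): the continuous extension of `moritaSeq p`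
to `ℤ_[p]`, i.e. the limit of `moritaSeq p n` as the natural number `n` tends to `x`
`p`-adically. The limit exists, and it is the unique continuous extension: see
`padicGamma_natCast`, `continuous_padicGamma` and `eq_padicGamma`. -/
noncomputable def padicGamma (p : ℕ) [Fact p.Prime] (x : ℤ_[p]) : ℤ_[p] :=
  limUnder (comap (Nat.cast : ℕ → ℤ_[p]) (𝓝 x)) (fun n => (moritaSeq p n : ℤ_[p]))

theorem moritaSeq_succ (p n : ℕ) :
    moritaSeq p (n + 1) = -(if Nat.Coprime n p then (n : ℤ) else 1) * moritaSeq p n := by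
  unfold moritaSeq
  rw [Finset.prod_filter, Finset.prod_filter, Finset.prod_range_succ, pow_succ]
  ring

theorem zmod_prime_pow_prod_units (p k : ℕ) [Fact p.Prime] (hp : p ≠ 2) (hk : k ≠ 0) :
    ∏ x : (ZMod (p ^ k))ˣ, x = -1 := by
  have hpp : p.Prime := Fact.out
  have h1 : 1 < p ^ k := Nat.one_lt_pow hk hpp.one_lt
  have h2p : 2 < p ^ k :=
    lt_of_lt_of_le (lt_of_le_of_ne hpp.two_le (Ne.symm hp)) (Nat.le_self_pow hk p)
  have : Fact (1 < p ^ k) := ⟨h1⟩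
  have : Fact (2 < p ^ k) := ⟨h2p⟩
  have hne : (-1 : (ZMod (p ^ k))ˣ) ≠ 1 := by
    intro h
    have h' := congrArg Units.val h
    rw [Units.val_neg, Units.val_one] at h'
    exact ZMod.neg_one_ne_one h'
  have hsq : ∀ x : (ZMod (p ^ k))ˣ, x⁻¹ = x → x = 1 ∨ x = -1 := by
    intro x hx
    obtain ⟨a, ha⟩ := ZMod.intCast_surjective (x : ZMod (p ^ k))
    have hxx : (x : ZMod (p ^ k)) * x = 1 := by
      have : x * x = 1 := by nth_rewrite 1 [← hx]; simp
      rw [← Units.val_mul, this, Units.val_one]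
    have hd : ((p : ℤ) ^ k) ∣ (a - 1) * (a + 1) := by
      have h0 : (((a - 1) * (a + 1) : ℤ) : ZMod (p ^ k)) = 0 := by
        push_cast
        rw [ha]
        linear_combination hxx
      have := (ZMod.intCast_zmod_eq_zero_iff_dvd _ _).mp h0
      exact_mod_cast this
    have hpi : Prime (p : ℤ) := Nat.prime_iff_prime_int.mp hpp
    have hnot : ¬ ((p : ℤ) ∣ a - 1 ∧ (p : ℤ) ∣ a + 1) := by
      rintro ⟨h1, h2⟩
      have h3 : (p : ℤ) ∣ 2 := by
        have := dvd_sub h2 h1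
        ring_nf at this
        exact this
      have h4 : p ∣ 2 := by exact_mod_cast h3
      exact hp ((Nat.prime_dvd_prime_iff_eq hpp Nat.prime_two).mp h4)
    by_cases h : (p : ℤ) ∣ a - 1
    · have hco : IsCoprime ((p : ℤ) ^ k) (a + 1) :=
        ((hpi.coprime_iff_not_dvd).mpr fun h' => hnot ⟨h, h'⟩).pow_left
      have h5 := hco.dvd_of_dvd_mul_right hd
      left
      ext
      have h6 : ((a - 1 : ℤ) : ZMod (p ^ k)) = 0 :=
        (ZMod.intCast_zmod_eq_zero_iff_dvd _ _).mpr (by exact_mod_cast h5)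
      push_cast at h6
      rw [ha] at h6
      rw [Units.val_one]
      exact sub_eq_zero.mp h6
    · have hco : IsCoprime ((p : ℤ) ^ k) (a - 1) :=
        ((hpi.coprime_iff_not_dvd).mpr h).pow_left
      have h5 := hco.dvd_of_dvd_mul_left hd
      right
      ext
      have h6 : ((a + 1 : ℤ) : ZMod (p ^ k)) = 0 :=
        (ZMod.intCast_zmod_eq_zero_iff_dvd _ _).mpr (by exact_mod_cast h5)
      push_cast at h6
      rw [ha] at h6
      rw [Units.val_neg, Units.val_one]
      exact eq_neg_of_add_eq_zero_left h6
  have hrest : ∏ x ∈ (Finset.univ.erase (1 : (ZMod (p ^ k))ˣ)).erase (-1), x = 1 := by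
    refine Finset.prod_involution (fun x _ => x⁻¹) ?_ ?_ ?_ ?_
    · intro x _
      simp
    · intro x hx _ h
      rcases hsq x h with h | h <;> simp [h] at hx
    · intro x hx
      simp only [Finset.mem_erase, Finset.mem_univ, and_true, ne_eq] at hx ⊢
      refine ⟨fun h => hx.1 ?_, fun h => hx.2 (inv_eq_one.mp h)⟩
      rw [← inv_inv x, h]
      simp
    · intro x _
      simp
  rw [← Finset.mul_prod_erase Finset.univ (fun x => x) (Finset.mem_univ 1),
    ← Finset.mul_prod_erase (Finset.univ.erase 1) (fun x => x)
      (Finset.mem_erase.mpr ⟨hne, Finset.mem_univ (-1)⟩), hrest]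
  simp

theorem moritaSeq_period (p k : ℕ) [Fact p.Prime] (hp : p ≠ 2) (n : ℕ) :
    ((moritaSeq p (n + p ^ k) : ℤ) : ZMod (p ^ k)) = (moritaSeq p n : ℤ) := by
  have hpp : p.Prime := Fact.out
  by_cases hk : k = 0
  · subst hk
    have : Subsingleton (ZMod (p ^ 0)) := by rw [pow_zero]; infer_instance
    exact Subsingleton.elim _ _
  have : NeZero (p ^ k) := ⟨pow_ne_zero k hpp.ne_zero⟩
  induction n with
  | zero =>
    have hodd : Odd (p ^ k) := (hpp.odd_of_ne_two hp).pow
    have hprod : ∏ j ∈ Finset.range (p ^ k),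
        (if Nat.Coprime j p then (j : ZMod (p ^ k)) else 1) = -1 := by
      classical
      have hu := congrArg Units.val (zmod_prime_pow_prod_units p k hp hk)
      rw [Units.coe_prod, Units.val_neg, Units.val_one] at hu
      rw [← hu, ← Finset.prod_filter]
      symm
      refine Finset.prod_bij (fun x _ => (x : ZMod (p ^ k)).val) ?_ ?_ ?_ ?_
      · intro x _
        rw [Finset.mem_filter, Finset.mem_range]
        exact ⟨ZMod.val_lt _, (Nat.coprime_pow_right_iff (Nat.pos_of_ne_zero hk) _ _).mp
          (ZMod.val_coe_unit_coprime x)⟩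
      · intro x _ y _ h
        exact Units.ext (ZMod.val_injective _ h)
      · intro j hj
        rw [Finset.mem_filter, Finset.mem_range] at hj
        refine ⟨ZMod.unitOfCoprime j (hj.2.pow_right k), Finset.mem_univ _, ?_⟩
        rw [ZMod.coe_unitOfCoprime, ZMod.val_natCast, Nat.mod_eq_of_lt hj.1]
      · intro x _
        rw [ZMod.natCast_zmod_val]
    have hL : ((moritaSeq p (p ^ k) : ℤ) : ZMod (p ^ k)) = 1 := by
      unfold moritaSeq
      rw [Finset.prod_filter]
      push_cast
      rw [hprod, hodd.neg_one_pow]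
      ring
    rw [zero_add, hL]
    simp [moritaSeq]
  | succ n ih =>
    have hc : Nat.Coprime (n + p ^ k) p ↔ Nat.Coprime n p := by
      obtain ⟨j, rfl⟩ := Nat.exists_eq_succ_of_ne_zero hk
      rw [pow_succ]
      simp
    rw [show n + 1 + p ^ k = n + p ^ k + 1 by ring, moritaSeq_succ, moritaSeq_succ p n,
      Int.cast_mul, Int.cast_mul, ih]
    congr 1
    simp only [hc]
    split_ifs
    · have h0 : ((p : ZMod (p ^ k))) ^ k = 0 := by exact_mod_cast ZMod.natCast_self (p ^ k)
      push_cast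
      rw [h0]
      ring
    · rfl

theorem moritaSeq_lipschitz (p : ℕ) [Fact p.Prime] (hp : p ≠ 2) (m n : ℕ) :
    ‖(moritaSeq p m : ℤ_[p]) - (moritaSeq p n : ℤ_[p])‖ ≤ ‖(m : ℤ_[p]) - (n : ℤ_[p])‖ := by
  wlog hmn : n ≤ m generalizing m n
  · rw [norm_sub_rev, norm_sub_rev (m : ℤ_[p])]
    exact this n m (le_of_not_ge hmn)
  obtain ⟨d, rfl⟩ := Nat.exists_eq_add_of_le hmn
  by_cases hd : d = 0
  · simp [hd]
  have hd0 : (d : ℤ_[p]) ≠ 0 := by exact_mod_cast hd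
  have hmul : ∀ k j : ℕ, ((moritaSeq p (n + j * p ^ k) : ℤ) : ZMod (p ^ k))
      = (moritaSeq p n : ℤ) := by
    intro k j
    induction j with
    | zero => simp
    | succ j ih => rw [Nat.succ_mul, ← add_assoc, moritaSeq_period p k hp, ih]
  have hsub : ((n + d : ℕ) : ℤ_[p]) - (n : ℤ_[p]) = (d : ℤ_[p]) := by push_cast; ring
  rw [hsub, PadicInt.norm_eq_zpow_neg_valuation hd0]
  set k := (d : ℤ_[p]).valuation with hkdef
  have hdvd : p ^ k ∣ d := by
    have h : ‖((d : ℤ) : ℤ_[p])‖ ≤ (p : ℝ) ^ (-(k : ℤ)) := by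
      rw [Int.cast_natCast]
      exact (PadicInt.norm_eq_zpow_neg_valuation hd0).le
    have := (PadicInt.norm_int_le_pow_iff_dvd (p := p) (k := (d : ℤ)) (n := k)).mp h
    exact_mod_cast this
  obtain ⟨j, hj⟩ := hdvd
  rw [← Int.cast_sub, PadicInt.norm_int_le_pow_iff_dvd]
  have h := hmul k j
  rw [mul_comm j, ← hj] at h
  have h' : ((moritaSeq p (n + d) - moritaSeq p n : ℤ) : ZMod (p ^ k)) = 0 := by
    rw [Int.cast_sub, h, sub_self]
  exact_mod_cast (ZMod.intCast_zmod_eq_zero_iff_dvd _ _).mp h'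

instance comap_natCast_nhds_neBot (p : ℕ) [Fact p.Prime] (x : ℤ_[p]) :
    NeBot (comap (Nat.cast : ℕ → ℤ_[p]) (𝓝 x)) :=
  comap_neBot fun t ht => by
    obtain ⟨_, hy, n, rfl⟩ := mem_closure_iff_nhds.mp (PadicInt.denseRange_natCast x) t ht
    exact ⟨n, hy⟩

/-- The limit that defines `padicGamma` exists. -/
theorem tendsto_padicGamma (p : ℕ) [Fact p.Prime] (hp : p ≠ 2) (x : ℤ_[p]) :
    Tendsto (fun n => (moritaSeq p n : ℤ_[p])) (comap (Nat.cast : ℕ → ℤ_[p]) (𝓝 x))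
      (𝓝 (padicGamma p x)) := by
  refine tendsto_nhds_limUnder (CompleteSpace.complete (f := map _ _) ?_)
  rw [Metric.cauchy_iff]
  refine ⟨inferInstance, fun ε hε => ?_⟩
  refine ⟨(fun n => (moritaSeq p n : ℤ_[p])) ''
    ((Nat.cast : ℕ → ℤ_[p]) ⁻¹' Metric.ball x (ε / 2)),
    image_mem_map (preimage_mem_comap (Metric.ball_mem_nhds x (half_pos hε))), ?_⟩
  rintro _ ⟨m, hm, rfl⟩ _ ⟨n, hn, rfl⟩
  have hm' : dist (m : ℤ_[p]) x < ε / 2 := hm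
  have hn' : dist (n : ℤ_[p]) x < ε / 2 := hn
  calc dist (moritaSeq p m : ℤ_[p]) (moritaSeq p n : ℤ_[p])
      ≤ dist (m : ℤ_[p]) (n : ℤ_[p]) := by
        rw [dist_eq_norm, dist_eq_norm]
        exact moritaSeq_lipschitz p hp m n
    _ ≤ dist (m : ℤ_[p]) x + dist (n : ℤ_[p]) x := dist_triangle_right _ _ _
    _ < ε := by linarith

theorem padicGamma_dist_natCast (p : ℕ) [Fact p.Prime] (hp : p ≠ 2) (x : ℤ_[p]) (n : ℕ) :
    dist (padicGamma p x) (moritaSeq p n : ℤ_[p]) ≤ dist x (n : ℤ_[p]) := by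
  have hc : Tendsto (Nat.cast : ℕ → ℤ_[p]) (comap (Nat.cast : ℕ → ℤ_[p]) (𝓝 x)) (𝓝 x) :=
    tendsto_comap
  refine le_of_tendsto_of_tendsto' ((tendsto_padicGamma p hp x).dist tendsto_const_nhds)
    (hc.dist tendsto_const_nhds) fun m => ?_
  rw [dist_eq_norm, dist_eq_norm]
  exact moritaSeq_lipschitz p hp m n

/-- `padicGamma` extends `moritaSeq`. -/
theorem padicGamma_natCast (p : ℕ) [Fact p.Prime] (hp : p ≠ 2) (n : ℕ) :
    padicGamma p (n : ℤ_[p]) = (moritaSeq p n : ℤ_[p]) :=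
  dist_le_zero.mp ((padicGamma_dist_natCast p hp n n).trans_eq (dist_self _))

theorem continuous_padicGamma (p : ℕ) [Fact p.Prime] (hp : p ≠ 2) :
    Continuous (padicGamma p) := by
  have hL : LipschitzWith 1 (padicGamma p) := by
    refine LipschitzWith.of_dist_le_mul fun x y => ?_
    rw [NNReal.coe_one, one_mul]
    have hc : Tendsto (Nat.cast : ℕ → ℤ_[p]) (comap (Nat.cast : ℕ → ℤ_[p]) (𝓝 y)) (𝓝 y) :=
      tendsto_comap
    exact le_of_tendsto_of_tendsto' (tendsto_const_nhds.dist (tendsto_padicGamma p hp y))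
      (tendsto_const_nhds.dist hc) fun n => padicGamma_dist_natCast p hp x n
  exact hL.continuous

/-- `padicGamma` is the only continuous function that extends `moritaSeq` from `n > 1`. -/
theorem eq_padicGamma (p : ℕ) [Fact p.Prime] (hp : p ≠ 2) (f : ℤ_[p] → ℤ_[p])
    (hf : Continuous f) (h : ∀ n : ℕ, 1 < n → f (n : ℤ_[p]) = (moritaSeq p n : ℤ_[p])) :
    f = padicGamma p := by
  have hshift : (fun x : ℤ_[p] => f (x + 2)) = fun x => padicGamma p (x + 2) := by
    refine PadicInt.denseRange_natCast.equalizer (by fun_prop)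
      ((continuous_padicGamma p hp).comp (by fun_prop)) ?_
    funext n
    have h1 := h (n + 2) (by omega)
    have h2 := padicGamma_natCast p hp (n + 2)
    push_cast at h1 h2
    simp only [Function.comp_apply]
    rw [h1, h2]
  funext x
  have := congrFun hshift (x - 2)
  simpa using this

/-- The `p`-adic integer `1/4`, for a prime `p > 3`. -/
noncomputable def padicQuarter (p : ℕ) [Fact p.Prime] (h3 : 3 < p) : ℤ_[p] :=
  ⟨1 / 4, by
    have hpp : p.Prime := Fact.out
    have h4 : ‖((4 : ℕ) : ℚ_[p])‖ = 1 := by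
      rw [Padic.norm_natCast_eq_one_iff]
      exact (Nat.Coprime.pow_right 2 ((Nat.coprime_primes hpp Nat.prime_two).mpr (by omega)) :
        Nat.Coprime p (2 ^ 2))
    have h4' : ‖(4 : ℚ_[p])‖ = 1 := by exact_mod_cast h4
    rw [norm_div, h4', norm_one, div_one]⟩

/-- The congruence `a ≡ b (mod p^r)` between `p`-adic numbers: `a - b ∈ p^r ℤ_p`. -/
def PadicCongr (p : ℕ) [Fact p.Prime] (r : ℕ) (a b : ℚ_[p]) : Prop :=
  ∃ z : ℤ_[p], a - b = (p : ℚ_[p]) ^ r * (z : ℚ_[p])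

/-!
Write `p = 2 n + 1`. Modulo `p²` one has `(1/2)ₖ² ≡ (-n)ₖ (n + 1)ₖ`, so both sums become sums over
`k` of `(-n)ₖ (n + 1)ₖ (1/2)ₖ / k!³` times a harmonic number. These terminating sums satisfy
recurrences in `n` with step two, found by Zeilberger's algorithm, and three of the four parity
cases have closed forms in `c = binom(2m, m) / 4 ^ m`, `m = ⌊n / 2⌋`. Since `Γₚ` does not increase
`p`-adic distances, `Γₚ(1/4)` is congruent to Morita's product at the integer `N` with
`4 N = 1 + 3 p²`; grouping its factors into blocks of length `p` and using Wilson's theorem relates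
`Γₚ(1/4)⁴` to `c²`. The remaining case, `H_k` for odd `n`, comes from expanding Dixon's sum
`₃F₂(1/2 + x, n + 1 - x, -n; 1)` to first order at `x = p²`.
-/

/-! ## Rising factorials and terminating sums -/

section Hypergeometric

open Finset

section Rising

variable {R : Type*} [CommRing R]

/-- The rising factorial `(x)_k = x (x + 1) ⋯ (x + k - 1)`. -/
noncomputable def rising (x : R) (k : ℕ) : R := (ascPochhammer R k).eval x

@[simp] theorem rising_zero (x : R) : rising x 0 = 1 := by simp [rising]

theorem rising_succ (x : R) (k : ℕ) : rising x (k + 1) = rising x k * (x + k) :=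
  ascPochhammer_succ_eval k x

theorem rising_eq_prod (x : R) (k : ℕ) : rising x k = ∏ j ∈ range k, (x + j) := by
  induction k with
  | zero => simp
  | succ k ih => rw [rising_succ, prod_range_succ, ih]

theorem rising_add (x : R) (j k : ℕ) : rising x (j + k) = rising x j * rising (x + j) k := by
  simp [rising, ← ascPochhammer_mul]

theorem mul_rising_add_one (x : R) (k : ℕ) : x * rising (x + 1) k = (x + k) * rising x k := by
  have h := rising_add x 1 k
  rw [add_comm, rising_succ, rising_succ, rising_zero] at h
  push_cast at h
  linear_combination -h

theorem rising_neg_natCast_eq_zero {n k : ℕ} (h : n < k) : rising (-(n : R)) k = 0 :=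
  ascPochhammer_eval_neg_coe_nat_of_lt h

theorem rising_one (k : ℕ) : rising (1 : R) k = k.factorial := ascPochhammer_eval_one R k

theorem factorial_mul_rising_natCast_add_one (n k : ℕ) :
    n.factorial * rising ((n : R) + 1) k = (n + k).factorial :=
  factorial_mul_ascPochhammer R n k

theorem rising_neg_natCast (n k : ℕ) :
    rising (-(n : R)) k = (-1) ^ k * (n.choose k * k.factorial) := by
  rw [rising, ascPochhammer_eval_neg_eq_descPochhammer, descPochhammer_eval_eq_descFactorial,
    Nat.descFactorial_eq_factorial_mul_choose]
  push_cast
  ring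

theorem rising_reflect (x : R) (n : ℕ) : rising x n = (-1) ^ n * rising (1 - x - n) n := by
  have hsign : (-1 : R) ^ n = ∏ _j ∈ range n, -1 := by simp
  rw [rising_eq_prod, rising_eq_prod, hsign, ← prod_range_reflect, ← prod_mul_distrib]
  refine prod_congr rfl fun j hj => ?_
  rw [mem_range] at hj
  push_cast [Nat.cast_sub (show j ≤ n - 1 by omega), Nat.cast_sub (show 1 ≤ n by omega)]
  ring

theorem rising_ne_zero [IsDomain R] {x : R} (hx : ∀ j : ℕ, x + j ≠ 0) (k : ℕ) :
    rising x k ≠ 0 := by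
  rw [rising_eq_prod]
  exact prod_ne_zero_iff.mpr fun j _ => hx j

end Rising

variable {K : Type*} [Field K]

/-- The generalized harmonic number `H_k^(r)`, as an element of a field. -/
def fieldHarmonic (K : Type*) [Field K] (r k : ℕ) : K := ∑ j ∈ range k, 1 / ((j : K) + 1) ^ r

@[simp] theorem fieldHarmonic_zero (r : ℕ) : fieldHarmonic K r 0 = 0 := by simp [fieldHarmonic]

theorem fieldHarmonic_succ (r k : ℕ) :
    fieldHarmonic K r (k + 1) = fieldHarmonic K r k + 1 / ((k : K) + 1) ^ r :=
  sum_range_succ _ k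

/-- The summand `(x)_k (y)_k (1/2)_k / k!³` of `₃F₂(x, y, 1/2; 1, 1; 1)`. -/
noncomputable def hyperTerm (x y : K) (k : ℕ) : K :=
  rising x k * rising y k * rising (1 / 2) k / (k.factorial : K) ^ 3

@[simp] theorem hyperTerm_zero (x y : K) : hyperTerm x y 0 = 1 := by simp [hyperTerm]

theorem hyperTerm_comm (x y : K) (k : ℕ) : hyperTerm x y k = hyperTerm y x k := by
  rw [hyperTerm, hyperTerm, mul_comm (rising x k)]

theorem hyperTerm_neg_natCast_eq_zero {n k : ℕ} (h : n < k) (y : K) :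
    hyperTerm (-(n : K)) y k = 0 := by
  simp [hyperTerm, rising_neg_natCast_eq_zero h]

theorem hyperTerm_add_one_left {x : K} (hx : x ≠ 0) (y : K) (k : ℕ) :
    hyperTerm (x + 1) y k = (x + k) / x * hyperTerm x y k := by
  have hrising : rising (x + 1) k = (x + k) / x * rising x k := by
    rw [div_mul_eq_mul_div, ← mul_rising_add_one, mul_div_cancel_left₀ _ hx]
  rw [hyperTerm, hyperTerm, hrising]
  ring

theorem hyperTerm_add_one_right (x : K) {y : K} (hy : y ≠ 0) (k : ℕ) :
    hyperTerm x (y + 1) k = (y + k) / y * hyperTerm x y k := by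
  rw [hyperTerm_comm, hyperTerm_add_one_left hy, hyperTerm_comm]

theorem hyperTerm_add_two_left {x : K} (hx : x ≠ 0) (hx' : x + 1 ≠ 0) (y : K) (k : ℕ) :
    hyperTerm (x + 2) y k = (x + k) * (x + 1 + k) / (x * (x + 1)) * hyperTerm x y k := by
  rw [← one_add_one_eq_two, ← add_assoc, hyperTerm_add_one_left hx', hyperTerm_add_one_left hx]
  field_simp

theorem hyperTerm_add_two_right (x : K) {y : K} (hy : y ≠ 0) (hy' : y + 1 ≠ 0) (k : ℕ) :
    hyperTerm x (y + 2) k = (y + k) * (y + 1 + k) / (y * (y + 1)) * hyperTerm x y k := by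
  rw [hyperTerm_comm, hyperTerm_add_two_left hy hy', hyperTerm_comm]

theorem hyperTerm_succ [CharZero K] (x y : K) (k : ℕ) :
    hyperTerm x y (k + 1)
      = hyperTerm x y k * ((x + k) * (y + k) * (1 / 2 + k) / ((k : K) + 1) ^ 3) := by
  have hfact : (k.factorial : K) ≠ 0 := Nat.cast_ne_zero.mpr k.factorial_ne_zero
  simp only [hyperTerm, rising_succ, Nat.factorial_succ, Nat.cast_mul, Nat.cast_succ]
  field_simp

/-- The summand `(-n)_k (n+1)_k (1/2)_k / k!³`. -/
noncomputable def legendreTerm (K : Type*) [Field K] (n k : ℕ) : K :=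
  hyperTerm (-(n : K)) (n + 1) k

/-- The summand `(-n-2)_k (n+1)_k (1/2)_k / k!³`, contiguous to both `legendreTerm K n k` and
`legendreTerm K (n + 2) k`. -/
noncomputable def shiftedTerm (K : Type*) [Field K] (n k : ℕ) : K :=
  hyperTerm (-((n : K) + 2)) (n + 1) k

/-- The terminating sum `∑_k (-n)_k (n+1)_k (1/2)_k / k!³ · c_k`. -/
noncomputable def legendreSum (K : Type*) [Field K] (c : ℕ → K) (n : ℕ) : K :=
  ∑ k ∈ range (n + 1), legendreTerm K n k * c k

/-- The terminating sum `∑_k k² (-n-2)_k (n+1)_k (1/2)_k / k!³`, which drives the recurrence of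
the harmonic Legendre sum. -/
noncomputable def shiftedSum (K : Type*) [Field K] (n : ℕ) : K :=
  ∑ k ∈ range (n + 3), (k : K) ^ 2 * shiftedTerm K n k

theorem legendreTerm_eq_zero {n k : ℕ} (h : n < k) : legendreTerm K n k = 0 :=
  hyperTerm_neg_natCast_eq_zero h _

theorem shiftedTerm_eq_zero {n k : ℕ} (h : n + 2 < k) : shiftedTerm K n k = 0 := by
  have := hyperTerm_neg_natCast_eq_zero (K := K) h (n + 1)
  rwa [Nat.cast_add, Nat.cast_two] at this

theorem legendreSum_eq_sum_range (c : ℕ → K) {n N : ℕ} (h : n < N) :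
    legendreSum K c n = ∑ k ∈ range N, legendreTerm K n k * c k := by
  refine sum_subset (range_mono h) fun k _ hk => ?_
  rw [legendreTerm_eq_zero (by simpa using hk), zero_mul]

theorem shiftedSum_eq_sum_range {n N : ℕ} (h : n + 2 < N) :
    shiftedSum K n = ∑ k ∈ range N, (k : K) ^ 2 * shiftedTerm K n k := by
  refine sum_subset (range_mono h) fun k _ hk => ?_
  rw [shiftedTerm_eq_zero (by rw [mem_range] at hk; omega), mul_zero]

variable [CharZero K]

theorem legendreTerm_eq_mul_shiftedTerm (n k : ℕ) :
    legendreTerm K n k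
      = ((n : K) + 2 - k) * (n + 1 - k) / ((n + 1) * (n + 2)) * shiftedTerm K n k := by
  have hn1 : (n : K) + 1 ≠ 0 := n.cast_add_one_ne_zero
  have hn2 : (n : K) + 2 ≠ 0 := by exact_mod_cast (n + 1).succ_ne_zero
  have hn1' : -((n : K) + 2) + 1 ≠ 0 := by
    rw [show -((n : K) + 2) + 1 = -(n + 1) by ring]; exact neg_ne_zero.mpr hn1
  have hcontig := hyperTerm_add_two_left (neg_ne_zero.mpr hn2) hn1' (n + 1) k
  rw [show -((n : K) + 2) + 2 = -n by ring] at hcontig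
  rw [legendreTerm, shiftedTerm, hcontig]
  congr 2 <;> ring

theorem legendreTerm_add_two (n k : ℕ) :
    legendreTerm K (n + 2) k
      = ((n : K) + 1 + k) * (n + 2 + k) / ((n + 1) * (n + 2)) * shiftedTerm K n k := by
  have hn1 : (n : K) + 1 ≠ 0 := n.cast_add_one_ne_zero
  have hn2 : (n : K) + 1 + 1 ≠ 0 := by exact_mod_cast (n + 1).succ_ne_zero
  have hcontig := hyperTerm_add_two_right (-((n : K) + 2)) hn1 hn2 k
  rw [legendreTerm, shiftedTerm, Nat.cast_add, Nat.cast_two, add_right_comm (n : K) 2 1, hcontig,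
    add_assoc (n : K) 1 1, one_add_one_eq_two]

theorem legendreTerm_add_two_sub (n k : ℕ) :
    legendreTerm K (n + 2) k - legendreTerm K n k
      = 2 * (2 * n + 3) / ((n + 1) * (n + 2)) * (k * shiftedTerm K n k) := by
  rw [legendreTerm_add_two, legendreTerm_eq_mul_shiftedTerm]
  ring

/-- The Zeilberger certificate behind the recurrence of `legendreSum`. -/
theorem legendreTerm_telescope (n k : ℕ) :
    ((n : K) + 2) ^ 2 * legendreTerm K (n + 2) k - (n + 1) ^ 2 * legendreTerm K n k
      = -(2 * (2 * n + 3) / ((n + 1) * (n + 2))) *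
        (((k + 1 : ℕ) : K) ^ 3 * shiftedTerm K n (k + 1) - (k : K) ^ 3 * shiftedTerm K n k) := by
  have hn1 : (n : K) + 1 ≠ 0 := n.cast_add_one_ne_zero
  have hn2 : (n : K) + 2 ≠ 0 := by exact_mod_cast (n + 1).succ_ne_zero
  have hk : (k : K) + 1 ≠ 0 := k.cast_add_one_ne_zero
  rw [legendreTerm_add_two, legendreTerm_eq_mul_shiftedTerm, shiftedTerm, shiftedTerm,
    hyperTerm_succ]
  push_cast
  field_simp
  ring

theorem legendreSum_recurrence (c : ℕ → K) (n : ℕ) :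
    ((n : K) + 2) ^ 2 * legendreSum K c (n + 2) - (n + 1) ^ 2 * legendreSum K c n
      = 2 * (2 * n + 3) / ((n + 1) * (n + 2)) * ∑ k ∈ range (n + 3),
        ((k + 1 : ℕ) : K) ^ 3 * shiftedTerm K n (k + 1) * (c (k + 1) - c k) := by
  have hboundary : ∑ k ∈ range (n + 3), (((k + 1 : ℕ) : K) ^ 3 * shiftedTerm K n (k + 1) * c (k + 1)
      - (k : K) ^ 3 * shiftedTerm K n k * c k) = 0 := by
    rw [sum_range_sub (fun k => (k : K) ^ 3 * shiftedTerm K n k * c k),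
      shiftedTerm_eq_zero (n + 2).lt_succ_self]
    simp
  set ρ : K := 2 * (2 * n + 3) / ((n + 1) * (n + 2))
  rw [legendreSum, legendreSum_eq_sum_range c (show n < n + 3 by omega), mul_sum, mul_sum,
    ← sum_sub_distrib, ← add_zero (ρ * _), ← mul_zero (-ρ), ← hboundary, mul_sum, mul_sum,
    ← sum_add_distrib]
  exact sum_congr rfl fun k _ => by linear_combination c k * legendreTerm_telescope (K := K) n k

theorem legendreSum_one_recurrence (n : ℕ) :
    ((n : K) + 2) ^ 2 * legendreSum K 1 (n + 2) = (n + 1) ^ 2 * legendreSum K 1 n := by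
  rw [← sub_eq_zero, legendreSum_recurrence]
  simp

theorem legendreSum_harmonic_one_recurrence (n : ℕ) :
    ((n : K) + 2) ^ 2 * legendreSum K (fieldHarmonic K 1) (n + 2)
      - (n + 1) ^ 2 * legendreSum K (fieldHarmonic K 1) n
      = 2 * (2 * n + 3) / ((n + 1) * (n + 2)) * shiftedSum K n := by
  rw [legendreSum_recurrence, shiftedSum_eq_sum_range (show n + 2 < n + 3 + 1 by omega),
    sum_range_succ' (fun k : ℕ => (k : K) ^ 2 * shiftedTerm K n k), Nat.cast_zero,
    zero_pow two_ne_zero, zero_mul, add_zero]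
  congr 1
  refine sum_congr rfl fun k _ => ?_
  have hk : (k : K) + 1 ≠ 0 := k.cast_add_one_ne_zero
  rw [fieldHarmonic_succ, add_sub_cancel_left]
  push_cast
  field_simp

theorem legendreSum_harmonic_two_recurrence (n : ℕ) :
    ((n : K) + 2) ^ 2 * legendreSum K (fieldHarmonic K 2) (n + 2)
      - (n + 1) ^ 2 * legendreSum K (fieldHarmonic K 2) n
      = legendreSum K 1 (n + 2) - legendreSum K 1 n := by
  rw [legendreSum_recurrence, legendreSum_eq_sum_range 1 (show n + 2 < n + 3 + 1 by omega),
    legendreSum_eq_sum_range 1 (show n < n + 3 + 1 by omega), ← sum_sub_distrib, mul_sum]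
  simp only [Pi.one_apply, mul_one, legendreTerm_add_two_sub]
  rw [sum_range_succ' _ (n + 3), Nat.cast_zero, zero_mul, mul_zero, add_zero]
  refine sum_congr rfl fun k _ => ?_
  have hk : (k : K) + 1 ≠ 0 := k.cast_add_one_ne_zero
  rw [fieldHarmonic_succ, add_sub_cancel_left]
  push_cast
  field_simp

theorem shiftedTerm_telescope (n k : ℕ) :
    (k : K) ^ 2 * (((n : K) + 2) * (n + 3) * (shiftedTerm K (n + 2) k - shiftedTerm K n k)
      + (2 * n + 5) * shiftedTerm K (n + 1) k)
      = -(2 * (2 * n + 5) / ((n + 1) * (n + 4))) *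
        (((k + 1 : ℕ) : K) ^ 3 * ((k + 1 : ℕ) - 1) ^ 2 * hyperTerm (-((n : K) + 4)) (n + 1) (k + 1)
          - (k : K) ^ 3 * (k - 1) ^ 2 * hyperTerm (-((n : K) + 4)) (n + 1) k) := by
  have hn1 : (n : K) + 1 ≠ 0 := n.cast_add_one_ne_zero
  have hn2 : (n : K) + 1 + 1 ≠ 0 := by exact_mod_cast (n + 1).succ_ne_zero
  have hn3 : -((n : K) + 4) + 1 ≠ 0 := by
    rw [show -((n : K) + 4) + 1 = -(n + 3 : ℕ) by push_cast; ring]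
    exact neg_ne_zero.mpr (by exact_mod_cast (n + 2).succ_ne_zero)
  have hn4 : -((n : K) + 4) ≠ 0 := neg_ne_zero.mpr (by exact_mod_cast (n + 3).succ_ne_zero)
  have hk : (k : K) + 1 ≠ 0 := k.cast_add_one_ne_zero
  have hshift0 := hyperTerm_add_two_left hn4 hn3 (n + 1) k
  have hshift1 := (hyperTerm_add_one_left hn4 (n + 1 + 1) k).trans
    (congrArg (_ * ·) (hyperTerm_add_one_right _ hn1 k))
  have hshift2 := hyperTerm_add_two_right (-((n : K) + 4)) hn1 hn2 k
  simp only [shiftedTerm, Nat.cast_add, Nat.cast_one, Nat.cast_ofNat]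
  rw [show -((n : K) + 2) = -(n + 4) + 2 by ring, show -((n : K) + 1 + 2) = -(n + 4) + 1 by ring,
    show -((n : K) + 2 + 2) = -(n + 4) by ring, add_right_comm (n : K) 2 1, hshift0, hshift1,
    hshift2, hyperTerm_succ]
  rw [show -((n : K) + 4) + 1 = -(n + 3) by ring] at hn3 ⊢
  rw [neg_ne_zero] at hn3 hn4
  field_simp
  ring

theorem shiftedSum_recurrence (n : ℕ) :
    ((n : K) + 2) * (n + 3) * (shiftedSum K (n + 2) - shiftedSum K n)
      + (2 * n + 5) * shiftedSum K (n + 1) = 0 := by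
  have hvanish := hyperTerm_neg_natCast_eq_zero (show n + 4 < n + 5 by omega) ((n : K) + 1)
  rw [Nat.cast_add, Nat.cast_ofNat] at hvanish
  rw [shiftedSum, shiftedSum_eq_sum_range (show n + 2 < n + 5 by omega),
    shiftedSum_eq_sum_range (show n + 1 + 2 < n + 5 by omega), ← sum_sub_distrib, mul_sum, mul_sum,
    ← sum_add_distrib]
  simp only [← mul_sub, mul_left_comm _ ((_ : K) ^ 2), ← mul_add, shiftedTerm_telescope]
  rw [← mul_sum, sum_range_sub
    (fun k => (k : K) ^ 3 * (k - 1) ^ 2 * hyperTerm (-((n : K) + 4)) (n + 1) k), hvanish]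
  simp

/-- The central binomial ratio `C(2m, m) / 4^m`, which is `(1/2)_m / m!`. -/
def centralRatio (K : Type*) [Field K] (m : ℕ) : K := m.centralBinom / 4 ^ m

@[simp] theorem centralRatio_zero : centralRatio K 0 = 1 := by simp [centralRatio]

theorem centralRatio_ne_zero (m : ℕ) : centralRatio K m ≠ 0 :=
  div_ne_zero (Nat.cast_ne_zero.mpr m.centralBinom_ne_zero) (pow_ne_zero _ (by norm_num))

theorem centralRatio_succ (m : ℕ) :
    centralRatio K (m + 1) = centralRatio K m * ((2 * m + 1) / (2 * (m + 1))) := by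
  have hm : (m : K) + 1 ≠ 0 := m.cast_add_one_ne_zero
  have hbinom : ((m : K) + 1) * (m + 1).centralBinom = 2 * (2 * m + 1) * m.centralBinom := by
    exact_mod_cast m.succ_mul_centralBinom_succ
  rw [centralRatio, centralRatio, pow_succ]
  field_simp
  linear_combination 2 * hbinom

theorem rising_half (m : ℕ) : rising (1 / 2 : K) m = m.factorial * centralRatio K m := by
  induction m with
  | zero => simp
  | succ m ih =>
    have hm : (m : K) + 1 ≠ 0 := m.cast_add_one_ne_zero
    rw [rising_succ, ih, centralRatio_succ, Nat.factorial_succ]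
    push_cast
    field_simp
    ring

theorem legendreSum_zero (c : ℕ → K) : legendreSum K c 0 = c 0 := by
  simp [legendreSum, legendreTerm]

theorem legendreSum_one (c : ℕ → K) : legendreSum K c 1 = c 0 - c 1 := by
  simp only [legendreSum, legendreTerm, hyperTerm, rising_eq_prod, sum_range_succ, prod_range_succ,
    range_zero, sum_empty, prod_empty]
  norm_num
  ring

theorem legendreSum_one_even (m : ℕ) : legendreSum K 1 (2 * m) = centralRatio K m ^ 2 := by
  induction m with
  | zero => simp [legendreSum_zero]
  | succ m ih =>
    have hrec := legendreSum_one_recurrence (K := K) (2 * m)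
    have hm : (m : K) + 1 ≠ 0 := m.cast_add_one_ne_zero
    push_cast at hrec
    rw [ih] at hrec
    rw [mul_add_one, centralRatio_succ]
    field_simp
    linear_combination hrec

theorem legendreSum_one_odd (m : ℕ) : legendreSum K 1 (2 * m + 1) = 0 := by
  induction m with
  | zero => simp [legendreSum_one]
  | succ m ih =>
    have hrec := legendreSum_one_recurrence (K := K) (2 * m + 1)
    have hm : ((2 * m + 1 : ℕ) : K) + 2 ≠ 0 := by exact_mod_cast (2 * m + 2).succ_ne_zero
    rw [ih, mul_zero] at hrec
    exact (mul_eq_zero.mp hrec).resolve_left (pow_ne_zero 2 hm)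

theorem shiftedSum_zero : shiftedSum K 0 = 1 / 2 := by
  simp only [shiftedSum, shiftedTerm, hyperTerm, rising_eq_prod, sum_range_succ, prod_range_succ,
    range_zero, sum_empty, prod_empty, Nat.factorial]
  norm_num

theorem shiftedSum_one : shiftedSum K 1 = -(3 / 4) := by
  simp only [shiftedSum, shiftedTerm, hyperTerm, rising_eq_prod, sum_range_succ, prod_range_succ,
    range_zero, sum_empty, prod_empty, Nat.factorial]
  norm_num

theorem shiftedSum_even_odd (m : ℕ) :
    shiftedSum K (2 * m) = (2 * m + 1) ^ 2 / 2 * centralRatio K m ^ 2 ∧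
    shiftedSum K (2 * m + 1) = -(m + 1) * (2 * m + 3) * centralRatio K (m + 1) ^ 2 := by
  induction m with
  | zero =>
    rw [centralRatio_succ]
    norm_num [shiftedSum_zero, shiftedSum_one]
  | succ m ih =>
    obtain ⟨heven, hodd⟩ := ih
    have hrec := shiftedSum_recurrence (K := K) (2 * m)
    have hrec' := shiftedSum_recurrence (K := K) (2 * m + 1)
    have hm1 : (m : K) + 1 ≠ 0 := m.cast_add_one_ne_zero
    have hm2 : (m : K) + 1 + 1 ≠ 0 := by exact_mod_cast (m + 1).succ_ne_zero
    have hm3 : 2 * (m : K) + 3 ≠ 0 := by exact_mod_cast (2 * m + 2).succ_ne_zero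
    have heven' : shiftedSum K (2 * (m + 1))
        = (2 * (m + 1 : ℕ) + 1) ^ 2 / 2 * centralRatio K (m + 1) ^ 2 := by
      rw [heven, hodd, centralRatio_succ] at hrec
      rw [mul_add_one, centralRatio_succ]
      apply mul_left_cancel₀ (mul_ne_zero (mul_ne_zero two_ne_zero hm1) hm3)
      push_cast at hrec ⊢
      rw [← sub_eq_zero, ← hrec]
      field_simp
      ring
    refine ⟨heven', ?_⟩
    rw [add_assoc (2 * m) 1 1, ← mul_add_one, hodd, heven'] at hrec'
    rw [centralRatio_succ, mul_add_one, add_right_comm]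
    apply mul_left_cancel₀ (mul_ne_zero hm3 (mul_ne_zero two_ne_zero hm2))
    push_cast at hrec' ⊢
    rw [← sub_eq_zero, ← hrec']
    field_simp
    ring

theorem legendreSum_harmonic_one_even (m : ℕ) :
    legendreSum K (fieldHarmonic K 1) (2 * m)
      = centralRatio K m ^ 2 * fieldHarmonic K 1 (2 * m) := by
  induction m with
  | zero => simp [legendreSum_zero]
  | succ m ih =>
    have hrec := legendreSum_harmonic_one_recurrence (K := K) (2 * m)
    have hm : (m : K) + 1 ≠ 0 := m.cast_add_one_ne_zero
    have hodd : 2 * (m : K) + 1 ≠ 0 := by exact_mod_cast (2 * m).succ_ne_zero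
    have heven : 2 * (m : K) + 1 + 1 = 2 * (m + 1) := by ring
    rw [ih, (shiftedSum_even_odd m).1, sub_eq_iff_eq_add] at hrec
    push_cast at hrec
    rw [mul_add_one, centralRatio_succ, fieldHarmonic_succ, fieldHarmonic_succ]
    apply mul_left_cancel₀ (pow_ne_zero 2 (mul_ne_zero two_ne_zero hm))
    rw [show (2 : K) * (m + 1) = 2 * m + 2 by ring, hrec]
    push_cast
    rw [heven, show 2 * (m : K) + 2 = 2 * (m + 1) by ring]
    field_simp
    ring

theorem legendreSum_harmonic_two_even (m : ℕ) :
    legendreSum K (fieldHarmonic K 2) (2 * m)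
      = centralRatio K m ^ 2 * ∑ j ∈ range (2 * m), (-1) ^ (j + 1) / ((j : K) + 1) ^ 2 := by
  induction m with
  | zero => simp [legendreSum_zero]
  | succ m ih =>
    have hrec := legendreSum_harmonic_two_recurrence (K := K) (2 * m)
    have hm : (m : K) + 1 ≠ 0 := m.cast_add_one_ne_zero
    have hodd : 2 * (m : K) + 1 ≠ 0 := by exact_mod_cast (2 * m).succ_ne_zero
    have heven : 2 * (m : K) + 1 + 1 = 2 * (m + 1) := by ring
    rw [ih, legendreSum_one_even, ← mul_add_one, legendreSum_one_even, centralRatio_succ,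
      sub_eq_iff_eq_add] at hrec
    push_cast at hrec
    rw [centralRatio_succ]
    apply mul_left_cancel₀ (pow_ne_zero 2 (mul_ne_zero two_ne_zero hm))
    rw [show (2 : K) * (m + 1) = 2 * m + 2 by ring, hrec, Nat.mul_succ, sum_range_succ,
      sum_range_succ]
    push_cast
    rw [heven, show 2 * (m : K) + 2 = 2 * (m + 1) by ring]
    simp only [pow_succ, pow_mul]
    field_simp
    ring

theorem legendreSum_harmonic_two_odd (m : ℕ) :
    legendreSum K (fieldHarmonic K 2) (2 * m + 1)
      = -(1 / ((2 * m + 1) * centralRatio K m) ^ 2) := by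
  induction m with
  | zero => simp [legendreSum_one, fieldHarmonic]
  | succ m ih =>
    have hrec := legendreSum_harmonic_two_recurrence (K := K) (2 * m + 1)
    have hm : (m : K) + 1 ≠ 0 := m.cast_add_one_ne_zero
    have hm3 : 2 * (m : K) + 3 ≠ 0 := by exact_mod_cast (2 * m + 2).succ_ne_zero
    have hodd : 2 * (m : K) + 1 ≠ 0 := by exact_mod_cast (2 * m).succ_ne_zero
    have hratio := centralRatio_ne_zero (K := K) m
    rw [ih, legendreSum_one_odd, show 2 * m + 1 + 2 = 2 * (m + 1) + 1 by ring, legendreSum_one_odd,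
      sub_self] at hrec
    rw [centralRatio_succ]
    apply mul_left_cancel₀ (pow_ne_zero 2 hm3)
    push_cast at hrec ⊢
    rw [show 2 * ((m : K) + 1) + 1 = 2 * m + 3 by ring]
    field_simp at hrec ⊢
    linear_combination hrec

end Hypergeometric

section Dixon

open Finset

variable {K : Type*} [Field K]

/-- The summand of the well-poised series `₃F₂(a, b, -n; 1 + a - b, 1 + a + n; 1)`. -/
noncomputable def dixonTerm (a b : K) (n k : ℕ) : K :=
  rising a k * rising b k * rising (-(n : K)) k /
    (k.factorial * rising (1 + a - b) k * rising (1 + a + n) k)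

/-- The hypergeometric term contiguous to both `dixonTerm a b n` and `dixonTerm a b (n + 1)`, in
which the certificate of the recurrence of Dixon's sum is expressed. -/
noncomputable def dixonKernel (a b : K) (n k : ℕ) : K :=
  rising a k * rising b k * rising (-((n : K) + 1)) k /
    (k.factorial * rising (1 + a - b) k * rising (1 + a + n) (k + 1))

theorem dixonTerm_eq_zero (a b : K) {n k : ℕ} (h : n < k) : dixonTerm a b n k = 0 := by
  simp [dixonTerm, rising_neg_natCast_eq_zero h]

theorem dixonKernel_eq_zero (a b : K) {n k : ℕ} (h : n + 1 < k) : dixonKernel a b n k = 0 := by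
  have hrising := rising_neg_natCast_eq_zero (R := K) h
  rw [Nat.cast_succ] at hrising
  rw [dixonKernel, hrising, mul_zero, zero_div]

variable {a b : K} (ha : ∀ j : ℕ, 1 + a + j ≠ 0)

include ha in
theorem one_add_add_natCast_add_ne_zero (n j : ℕ) : 1 + a + n + j ≠ 0 := by
  simpa [add_assoc] using ha (n + j)

include ha in
theorem dixonTerm_succ_eq_mul_kernel (n k : ℕ) :
    dixonTerm a b (n + 1) k = (1 + a + n) * dixonKernel a b n k := by
  have han : 1 + a + n ≠ 0 := ha n
  have hshift := mul_rising_add_one (1 + a + n) k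
  rw [dixonTerm, dixonKernel, rising_succ (1 + a + n), mul_comm (rising (1 + a + n) k), ← hshift]
  push_cast
  rw [← add_assoc (1 + a)]
  field_simp

variable [CharZero K]

include ha in
theorem dixonTerm_eq_mul_kernel (n k : ℕ) :
    dixonTerm a b n k = (1 + a + n + k) * (n + 1 - k) / (n + 1) * dixonKernel a b n k := by
  have hn : (n : K) + 1 ≠ 0 := n.cast_add_one_ne_zero
  have hank := one_add_add_natCast_add_ne_zero ha n k
  have hshift := mul_rising_add_one (-((n : K) + 1)) k
  rw [show -((n : K) + 1) + 1 = -n by ring] at hshift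
  have hrising : rising (-(n : K)) k = (n + 1 - k) / (n + 1) * rising (-((n : K) + 1)) k := by
    field_simp
    linear_combination -hshift
  rw [dixonTerm, dixonKernel, hrising, rising_succ (1 + a + n), mul_comm (rising (1 + a + n) k)]
  field_simp

include ha in
theorem dixonKernel_succ (hab : ∀ j : ℕ, 1 + a - b + j ≠ 0) (n k : ℕ) :
    dixonKernel a b n (k + 1) = dixonKernel a b n k *
      ((a + k) * (b + k) * (k - n - 1) / ((k + 1) * (1 + a - b + k) * (1 + a + n + k + 1))) := by
  have hank := one_add_add_natCast_add_ne_zero ha n k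
  have hank' := one_add_add_natCast_add_ne_zero ha n (k + 1)
  have habk := hab k
  have hk : (k : K) + 1 ≠ 0 := k.cast_add_one_ne_zero
  have hfact : (k.factorial : K) ≠ 0 := Nat.cast_ne_zero.mpr k.factorial_ne_zero
  rw [Nat.cast_succ, ← add_assoc] at hank'
  simp only [dixonKernel, rising_succ, Nat.factorial_succ, Nat.cast_mul, Nat.cast_succ,
    ← add_assoc]
  field_simp
  ring

include ha in
/-- The Zeilberger certificate behind Dixon's sum. -/
theorem dixonTerm_telescope (hab : ∀ j : ℕ, 1 + a - b + j ≠ 0) (n k : ℕ) :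
    (1 + a / 2 + n) * (1 + a - b + n) * dixonTerm a b (n + 1) k
      - (1 + a + n) * (1 + a / 2 - b + n) * dixonTerm a b n k
      = -(1 + a + n) / (2 * (n + 1)) *
        ((k + 1 : ℕ) * ((k + 1 : ℕ) + a - b) * (1 + a + n + (k + 1 : ℕ)) *
          dixonKernel a b n (k + 1) - k * (k + a - b) * (1 + a + n + k) * dixonKernel a b n k) := by
  have hank' := one_add_add_natCast_add_ne_zero ha n (k + 1)
  have habk := hab k
  have hk : (k : K) + 1 ≠ 0 := k.cast_add_one_ne_zero
  have hn : (n : K) + 1 ≠ 0 := n.cast_add_one_ne_zero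
  rw [dixonTerm_succ_eq_mul_kernel ha, dixonTerm_eq_mul_kernel ha, dixonKernel_succ ha hab]
  push_cast at hank' ⊢
  rw [← add_assoc] at hank' ⊢
  rw [show (k : K) + 1 + a - b = 1 + a - b + k by ring]
  field_simp
  ring

include ha in
theorem dixon_recurrence (hab : ∀ j : ℕ, 1 + a - b + j ≠ 0) (n : ℕ) :
    (1 + a / 2 + n) * (1 + a - b + n) * ∑ k ∈ range (n + 2), dixonTerm a b (n + 1) k
      = (1 + a + n) * (1 + a / 2 - b + n) * ∑ k ∈ range (n + 1), dixonTerm a b n k := by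
  have hextend : ∑ k ∈ range (n + 1), dixonTerm a b n k = ∑ k ∈ range (n + 2), dixonTerm a b n k :=
    by rw [sum_range_succ _ (n + 1), dixonTerm_eq_zero a b n.lt_succ_self, add_zero]
  rw [hextend, ← sub_eq_zero, mul_sum, mul_sum, ← sum_sub_distrib]
  simp only [dixonTerm_telescope ha hab]
  rw [← mul_sum, sum_range_sub
    (fun k : ℕ => (k : K) * (k + a - b) * (1 + a + n + k) * dixonKernel a b n k),
    dixonKernel_eq_zero a b (n + 1).lt_succ_self]
  simp

include ha in
theorem dixon_sum (hab : ∀ j : ℕ, 1 + a - b + j ≠ 0) (ha2 : ∀ j : ℕ, 1 + a / 2 + j ≠ 0) (n : ℕ) :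
    ∑ k ∈ range (n + 1), dixonTerm a b n k
      = rising (1 + a) n * rising (1 + a / 2 - b) n /
        (rising (1 + a / 2) n * rising (1 + a - b) n) := by
  induction n with
  | zero => simp [dixonTerm]
  | succ n ih =>
    have hrising := rising_ne_zero hab n
    have hrising2 := rising_ne_zero ha2 n
    have habn := hab n
    have ha2n := ha2 n
    apply mul_left_cancel₀ (mul_ne_zero ha2n habn)
    rw [dixon_recurrence ha hab n, ih, rising_succ, rising_succ, rising_succ, rising_succ]
    generalize 1 + a / 2 = c at *
    field_simp

end Dixon

/-! ## Congruences in a subring -/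

section CongrMod

open Finset

/-- The congruence `x ≡ y` modulo the multiples of `c` in a subring `S`, for elements of an ambient
ring. Membership of both sides in `S` is part of the notion, so that congruences can be multiplied
without further conditions. -/
def CongrMod {R : Type*} [CommRing R] (S : Subring R) (c x y : R) : Prop :=
  x ∈ S ∧ y ∈ S ∧ ∃ z ∈ S, x - y = c * z

namespace CongrMod

variable {R : Type*} [CommRing R] {S : Subring R} {c d x y z w : R}

theorem left_mem (h : CongrMod S c x y) : x ∈ S := h.1

theorem right_mem (h : CongrMod S c x y) : y ∈ S := h.2.1

theorem refl (hx : x ∈ S) : CongrMod S c x x := ⟨hx, hx, 0, zero_mem S, by ring⟩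

theorem symm : CongrMod S c x y → CongrMod S c y x := by
  rintro ⟨hx, hy, u, hu, hxy⟩
  exact ⟨hy, hx, -u, neg_mem hu, by linear_combination -hxy⟩

theorem trans : CongrMod S c x y → CongrMod S c y z → CongrMod S c x z := by
  rintro ⟨hx, _, u, hu, hxy⟩ ⟨_, hz, v, hv, hyz⟩
  exact ⟨hx, hz, u + v, add_mem hu hv, by linear_combination hxy + hyz⟩

instance : Trans (CongrMod S c) (CongrMod S c) (CongrMod S c) := ⟨trans⟩

theorem add : CongrMod S c x y → CongrMod S c z w → CongrMod S c (x + z) (y + w) := by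
  rintro ⟨hx, hy, u, hu, hxy⟩ ⟨hz, hw, v, hv, hzw⟩
  exact ⟨add_mem hx hz, add_mem hy hw, u + v, add_mem hu hv, by linear_combination hxy + hzw⟩

theorem neg : CongrMod S c x y → CongrMod S c (-x) (-y) := by
  rintro ⟨hx, hy, u, hu, hxy⟩
  exact ⟨neg_mem hx, neg_mem hy, -u, neg_mem hu, by linear_combination -hxy⟩

theorem sub (hxy : CongrMod S c x y) (hzw : CongrMod S c z w) :
    CongrMod S c (x - z) (y - w) := by
  simpa only [sub_eq_add_neg] using hxy.add hzw.neg

theorem mul : CongrMod S c x y → CongrMod S c z w → CongrMod S c (x * z) (y * w) := by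
  rintro ⟨hx, hy, u, hu, hxy⟩ ⟨hz, hw, v, hv, hzw⟩
  exact ⟨mul_mem hx hz, mul_mem hy hw, u * z + y * v, add_mem (mul_mem hu hz) (mul_mem hy hv),
    by linear_combination z * hxy + y * hzw⟩

theorem mul_left (hz : z ∈ S) (h : CongrMod S c x y) : CongrMod S c (z * x) (z * y) :=
  (refl hz).mul h

theorem mul_right (hz : z ∈ S) (h : CongrMod S c x y) : CongrMod S c (x * z) (y * z) :=
  h.mul (refl hz)

theorem sum {ι : Type*} {s : Finset ι} {f g : ι → R} (h : ∀ i ∈ s, CongrMod S c (f i) (g i)) :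
    CongrMod S c (∑ i ∈ s, f i) (∑ i ∈ s, g i) := by
  classical
  induction s using Finset.induction_on with
  | empty => simpa using refl (zero_mem S)
  | insert a s ha ih =>
    rw [sum_insert ha, sum_insert ha]
    exact (h a (mem_insert_self a s)).add (ih fun i hi => h i (mem_insert_of_mem hi))

theorem prod {ι : Type*} {s : Finset ι} {f g : ι → R} (h : ∀ i ∈ s, CongrMod S c (f i) (g i)) :
    CongrMod S c (∏ i ∈ s, f i) (∏ i ∈ s, g i) := by
  classical
  induction s using Finset.induction_on with
  | empty => simpa using refl (one_mem S)
  | insert a s ha ih =>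
    rw [prod_insert ha, prod_insert ha]
    exact (h a (mem_insert_self a s)).mul (ih fun i hi => h i (mem_insert_of_mem hi))

theorem pow (h : CongrMod S c x y) (m : ℕ) : CongrMod S c (x ^ m) (y ^ m) := by
  simpa only [prod_const, card_range] using prod (s := range m) fun _ _ => h

theorem scale (hd : d ∈ S) : CongrMod S c x y → CongrMod S (d * c) (d * x) (d * y) := by
  rintro ⟨hx, hy, u, hu, hxy⟩
  exact ⟨mul_mem hd hx, mul_mem hd hy, u, hu, by linear_combination d * hxy⟩

theorem scale_self (hc : c ∈ S) (h : CongrMod S c x y) : CongrMod S (c ^ 2) (c * x) (c * y) := by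
  rw [sq]
  exact h.scale hc

theorem add_mul_self (hx : x ∈ S) (hc : c ∈ S) (hz : z ∈ S) : CongrMod S c (x + c * z) x :=
  ⟨add_mem hx (mul_mem hc hz), hx, z, hz, by ring⟩

theorem of_scale [IsDomain R] (hd : d ≠ 0) (hx : x ∈ S) (hy : y ∈ S) :
    CongrMod S (d * c) (d * x) (d * y) → CongrMod S c x y := by
  rintro ⟨_, _, u, hu, hxy⟩
  exact ⟨hx, hy, u, hu, mul_left_cancel₀ hd (by linear_combination hxy)⟩

theorem of_dvd (hd : d ∈ S) : CongrMod S (c * d) x y → CongrMod S c x y := by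
  rintro ⟨hx, hy, u, hu, hxy⟩
  exact ⟨hx, hy, d * u, mul_mem hd hu, by linear_combination hxy⟩

theorem rising (h : CongrMod S c x y) (k : ℕ) : CongrMod S c (rising x k) (rising y k) := by
  rw [rising_eq_prod, rising_eq_prod]
  exact prod fun j _ => h.add (refl (natCast_mem S j))

end CongrMod

theorem rising_mem {R : Type*} [CommRing R] {S : Subring R} {x : R} (hx : x ∈ S) (k : ℕ) :
    rising x k ∈ S :=
  ((CongrMod.refl (c := 0) hx).rising k).left_mem

/-- `x` is `1 + c α` modulo `c²`: the slopes `α` of such elements add up under products. -/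
def HasSlope {R : Type*} [CommRing R] (S : Subring R) (c x α : R) : Prop :=
  α ∈ S ∧ CongrMod S (c ^ 2) x (1 + c * α)

namespace HasSlope

variable {R : Type*} [CommRing R] {S : Subring R} {c x y α β : R}

theorem one_add (hc : c ∈ S) (hα : α ∈ S) : HasSlope S c (1 + c * α) α :=
  ⟨hα, .refl (add_mem (one_mem S) (mul_mem hc hα))⟩

theorem one : HasSlope S c 1 0 :=
  ⟨zero_mem S, by simpa using CongrMod.refl (one_mem S)⟩

theorem mul (hx : HasSlope S c x α) (hy : HasSlope S c y β) : HasSlope S c (x * y) (α + β) := by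
  refine ⟨add_mem hx.1 hy.1, ?_⟩
  obtain ⟨hxy, -, u, hu, heq⟩ := hx.2.mul hy.2
  refine ⟨hxy, ?_, u + α * β, add_mem hu (mul_mem hx.1 hy.1), by linear_combination heq⟩
  have hx' := sub_mem hx.2.right_mem (one_mem S)
  have hy' := hy.2.right_mem
  rw [show 1 + c * (α + β) = 1 + c * α - 1 + (1 + c * β) by ring]
  exact add_mem hx' hy'

theorem prod {ι : Type*} {s : Finset ι} {f g : ι → R} (h : ∀ i ∈ s, HasSlope S c (f i) (g i)) :
    HasSlope S c (∏ i ∈ s, f i) (∑ i ∈ s, g i) := by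
  classical
  induction s using Finset.induction_on with
  | empty => simpa using one
  | insert a s ha ih =>
    rw [prod_insert ha, sum_insert ha]
    exact (h a (mem_insert_self a s)).mul (ih fun i hi => h i (mem_insert_of_mem hi))

theorem pow (h : HasSlope S c x α) (m : ℕ) : HasSlope S c (x ^ m) (m * α) := by
  simpa using prod (s := range m) fun _ _ => h

theorem congrMod_one (hc : c ∈ S) (h : HasSlope S c x α) : CongrMod S c x 1 :=
  .trans (.of_dvd hc (by rw [← sq]; exact h.2)) (.add_mul_self (one_mem S) hc h.1)

theorem congrMod_sq_one (hc : c ∈ S) (h : HasSlope S c x α) (hα : CongrMod S c α 0) :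
    CongrMod S (c ^ 2) x 1 := by
  simpa using h.2.trans ((CongrMod.refl (one_mem S)).add (hα.scale_self hc))

end HasSlope

/-- The third coefficient uses `2 ∑_{i < j} fᵢ fⱼ = (∑ fᵢ)² - ∑ fᵢ²`. -/
theorem prod_one_add_mul_congrMod_cube {R ι : Type*} [Field R] [NeZero (2 : R)] {S : Subring R}
    {c : R} (hc : c ∈ S) (hhalf : 1 / 2 ∈ S) {s : Finset ι} {f : ι → R} (hf : ∀ i ∈ s, f i ∈ S) :
    CongrMod S (c ^ 3) (∏ i ∈ s, (1 + c * f i))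
      (1 + c * ∑ i ∈ s, f i
        + c ^ 2 * (1 / 2 * ((∑ i ∈ s, f i) ^ 2 - ∑ i ∈ s, f i ^ 2))) := by
  classical
  induction s using Finset.induction_on with
  | empty => simpa using CongrMod.refl (one_mem S)
  | insert a s ha ih =>
    have h2 : (2 : R) ≠ 0 := NeZero.ne 2
    have hfa := hf a (mem_insert_self a s)
    have hfs : ∀ i ∈ s, f i ∈ S := fun i hi => hf i (mem_insert_of_mem hi)
    have hsum : ∑ i ∈ s, f i ∈ S := sum_mem hfs
    have hsumsq : ∑ i ∈ s, f i ^ 2 ∈ S := sum_mem fun i hi => pow_mem (hfs i hi) 2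
    rw [prod_insert ha, sum_insert ha, sum_insert ha]
    obtain ⟨hprod, -, u, hu, heq⟩ := ih hfs
    clear ih hf hfs
    generalize ∑ i ∈ s, f i = A at *
    generalize ∑ i ∈ s, f i ^ 2 = B at *
    refine ⟨mul_mem (add_mem (one_mem S) (mul_mem hc hfa)) hprod, ?_,
      u * (1 + c * f a) + f a * (1 / 2 * (A ^ 2 - B)), ?_, ?_⟩
    · apply_rules [add_mem, sub_mem, mul_mem, pow_mem, one_mem]
    · apply_rules [add_mem, sub_mem, mul_mem, pow_mem, one_mem]
    · field_simp at heq ⊢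
      linear_combination (1 + c * f a) * heq

end CongrMod

/-! ## Congruences between `p`-adic integers -/

section Padic

open Finset

variable {p : ℕ} [Fact p.Prime]

local notation "𝒪" => PadicInt.subring p

local notation:50 x:51 "≡[" c "]" y:51 => CongrMod (PadicInt.subring p) c x y

local notation "qₚ" => ((fermatQuotient p 2 : ℚ) : ℚ_[p])

theorem mem_of_norm_eq_one {x : ℚ_[p]} (h : ‖x‖ = 1) : x ∈ 𝒪 :=
  (PadicInt.mem_subring_iff p).mpr h.le

theorem ne_zero_of_norm_eq_one {x : ℚ_[p]} (h : ‖x‖ = 1) : x ≠ 0 :=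
  norm_ne_zero_iff.mp (h ▸ one_ne_zero)

theorem inv_mem_of_norm_eq_one {x : ℚ_[p]} (h : ‖x‖ = 1) : x⁻¹ ∈ 𝒪 :=
  mem_of_norm_eq_one (by rw [norm_inv, h, inv_one])

theorem div_mem_of_norm_eq_one {x y : ℚ_[p]} (hx : x ∈ 𝒪) (hy : ‖y‖ = 1) : x / y ∈ 𝒪 := by
  rw [div_eq_mul_inv]
  exact mul_mem hx (inv_mem_of_norm_eq_one hy)

namespace CongrMod

variable {c d x y z w : ℚ_[p]}

theorem inv (h : x ≡[c] y) (hx : ‖x‖ = 1) (hy : ‖y‖ = 1) : x⁻¹ ≡[c] y⁻¹ := by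
  obtain ⟨-, -, u, hu, hxy⟩ := h
  have hx0 := ne_zero_of_norm_eq_one hx
  have hy0 := ne_zero_of_norm_eq_one hy
  have hx' := inv_mem_of_norm_eq_one hx
  have hy' := inv_mem_of_norm_eq_one hy
  refine ⟨hx', hy', -u * x⁻¹ * y⁻¹, mul_mem (mul_mem (neg_mem hu) hx') hy', ?_⟩
  field_simp
  linear_combination -hxy

theorem div (hxy : x ≡[c] y) (hzw : z ≡[c] w) (hz : ‖z‖ = 1) (hw : ‖w‖ = 1) :
    x / z ≡[c] y / w := by
  rw [div_eq_mul_inv, div_eq_mul_inv]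
  exact hxy.mul (hzw.inv hz hw)

theorem of_mul_left (hd : ‖d‖ = 1) (h : d * x ≡[c] d * y) : x ≡[c] y := by
  have := h.mul_left (inv_mem_of_norm_eq_one hd)
  rwa [inv_mul_cancel_left₀ (ne_zero_of_norm_eq_one hd),
    inv_mul_cancel_left₀ (ne_zero_of_norm_eq_one hd)] at this

theorem of_sq (h : x ≡[(p : ℚ_[p]) ^ 2] y) : x ≡[p] y :=
  of_dvd (natCast_mem 𝒪 p) (by rwa [← sq])

theorem norm_eq_one (h : x ≡[p] y) (hy : ‖y‖ = 1) : ‖x‖ = 1 := by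
  obtain ⟨-, -, u, hu, hxy⟩ := h
  have hlt : ‖x - y‖ < ‖y‖ := by
    rw [hxy, norm_mul, hy]
    exact mul_lt_one_of_nonneg_of_lt_one_left (norm_nonneg _) Padic.norm_p_lt_one
      ((PadicInt.mem_subring_iff p).mp hu)
  have hmax := IsUltrametricDist.norm_add_eq_max_of_norm_ne_norm hlt.ne
  rwa [sub_add_cancel, max_eq_right hlt.le, hy] at hmax

end CongrMod

theorem HasSlope.inv {c x α : ℚ_[p]} (h : HasSlope 𝒪 c x α) (hx : ‖x‖ = 1) :
    HasSlope 𝒪 c x⁻¹ (-α) := by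
  have hsub : 1 - c * α ∈ 𝒪 := by
    rw [show 1 - c * α = (2 : ℕ) - (1 + c * α) by push_cast; ring]
    exact sub_mem (natCast_mem 𝒪 2) h.2.right_mem
  refine ⟨neg_mem h.1, ?_⟩
  rw [mul_neg, ← sub_eq_add_neg]
  refine .of_mul_left hx ?_
  rw [mul_inv_cancel₀ (ne_zero_of_norm_eq_one hx)]
  obtain ⟨hmem, -, u, hu, heq⟩ := h.2.mul_right hsub
  exact ⟨one_mem 𝒪, hmem, α ^ 2 - u, sub_mem (pow_mem h.1 2) hu, by linear_combination -heq⟩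

theorem HasSlope.div {c x y α β : ℚ_[p]} (hxα : HasSlope 𝒪 c x α) (hyβ : HasSlope 𝒪 c y β)
    (hy : ‖y‖ = 1) : HasSlope 𝒪 c (x / y) (α - β) := by
  rw [div_eq_mul_inv, sub_eq_add_neg]
  exact hxα.mul (hyβ.inv hy)

theorem norm_prod_eq_one {ι : Type*} {s : Finset ι} {f : ι → ℚ_[p]} (h : ∀ i ∈ s, ‖f i‖ = 1) :
    ‖∏ i ∈ s, f i‖ = 1 := by
  rw [norm_prod]
  exact prod_eq_one h

theorem norm_natCast_eq_one {j : ℕ} (h0 : j ≠ 0) (hj : j < p) : ‖(j : ℚ_[p])‖ = 1 :=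
  Padic.norm_natCast_eq_one_iff.mpr (Nat.coprime_of_lt_prime h0 hj Fact.out)

theorem norm_natCast_add_one_eq_one {j : ℕ} (hj : j + 1 < p) : ‖(j : ℚ_[p]) + 1‖ = 1 := by
  exact_mod_cast norm_natCast_eq_one j.succ_ne_zero hj

theorem norm_factorial_eq_one {k : ℕ} (hk : k < p) : ‖(k.factorial : ℚ_[p])‖ = 1 :=
  Padic.norm_natCast_eq_one_iff.mpr (Nat.Prime.coprime_factorial_of_lt Fact.out hk)

theorem norm_two_eq_one (hp : p ≠ 2) : ‖(2 : ℚ_[p])‖ = 1 := by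
  have h2 := (Fact.out : p.Prime).two_le
  exact_mod_cast norm_natCast_eq_one two_ne_zero (by omega)

theorem one_half_mem (hp : p ≠ 2) : (1 / 2 : ℚ_[p]) ∈ 𝒪 :=
  div_mem_of_norm_eq_one (one_mem 𝒪) (norm_two_eq_one hp)

theorem norm_rising_eq_one {x : ℚ_[p]} {n : ℕ} (hx : ∀ j < n, ‖x + j‖ = 1) : ‖rising x n‖ = 1 := by
  rw [rising_eq_prod]
  exact norm_prod_eq_one fun j hj => hx j (mem_range.mp hj)

theorem rising_add_div_rising {K : Type*} [Field K] {x : K} {n : ℕ} (hx : ∀ j < n, x + j ≠ 0)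
    (y : K) : rising (x + y) n / rising x n = ∏ j ∈ range n, (1 + y * (1 / (x + j))) := by
  rw [rising_eq_prod, rising_eq_prod, ← prod_div_distrib]
  refine prod_congr rfl fun j hj => ?_
  rw [add_right_comm, add_div, div_self (hx j (mem_range.mp hj)), mul_one_div]

theorem hasSlope_rising_div_rising {c x y : ℚ_[p]} {n : ℕ} (hc : c ∈ 𝒪) (hy : y ∈ 𝒪)
    (hx : ∀ j < n, ‖x + j‖ = 1) :
    HasSlope 𝒪 c (rising (x + c * y) n / rising x n) (y * ∑ j ∈ range n, 1 / (x + j)) := by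
  rw [rising_add_div_rising fun j hj => ne_zero_of_norm_eq_one (hx j hj), mul_sum]
  simp only [mul_assoc]
  exact .prod fun j hj => .one_add hc
    (mul_mem hy (div_mem_of_norm_eq_one (one_mem 𝒪) (hx j (mem_range.mp hj))))

theorem fieldHarmonic_mem (r : ℕ) {k : ℕ} (hk : k < p) : fieldHarmonic ℚ_[p] r k ∈ 𝒪 := by
  refine sum_mem fun j hj => div_mem_of_norm_eq_one (one_mem 𝒪) ?_
  rw [mem_range] at hj
  rw [norm_pow, norm_natCast_add_one_eq_one (by omega), one_pow]

/-- With `p = 2 n + 1`, the factors satisfy `(1/2 + j)² - (-n + j)(n + 1 + j) = p² / 4`. -/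
theorem hyperTerm_half_congrMod {n k : ℕ} (hn : p = 2 * n + 1) (hk : k < p) :
    hyperTerm (1 / 2) (1 / 2) k ≡[(p : ℚ_[p]) ^ 2] legendreTerm ℚ_[p] n k := by
  have hpn : (p : ℚ_[p]) = 2 * n + 1 := by exact_mod_cast congrArg (Nat.cast : ℕ → ℚ_[p]) hn
  have hhalf := one_half_mem (p := p) (by omega)
  have hprod : rising (1 / 2) k * rising (1 / 2) k ≡[(p : ℚ_[p]) ^ 2]
      rising (-(n : ℚ_[p])) k * rising ((n : ℚ_[p]) + 1) k := by
    simp only [rising_eq_prod, ← prod_mul_distrib]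
    refine .prod fun j _ => ⟨mul_mem ?_ ?_, mul_mem ?_ ?_, 1 / 2 * (1 / 2), mul_mem hhalf hhalf, ?_⟩
    · exact add_mem hhalf (natCast_mem 𝒪 j)
    · exact add_mem hhalf (natCast_mem 𝒪 j)
    · exact add_mem (neg_mem (natCast_mem 𝒪 n)) (natCast_mem 𝒪 j)
    · exact add_mem (add_mem (natCast_mem 𝒪 n) (one_mem 𝒪)) (natCast_mem 𝒪 j)
    · rw [hpn]; ring
  rw [legendreTerm, hyperTerm, hyperTerm, mul_div_assoc, mul_div_assoc]
  exact hprod.mul_right (div_mem_of_norm_eq_one (rising_mem hhalf k)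
    (by rw [norm_pow, norm_factorial_eq_one hk, one_pow]))

theorem hyperTerm_half_half {K : Type*} [Field K] [CharZero K] (k : ℕ) :
    hyperTerm (1 / 2 : K) (1 / 2) k = centralRatio K k ^ 3 := by
  have hfact : (k.factorial : K) ≠ 0 := Nat.cast_ne_zero.mpr k.factorial_ne_zero
  rw [hyperTerm, rising_half]
  field_simp

theorem genHarmonic_cast {K : Type*} [Field K] [CharZero K] (r k : ℕ) :
    ((genHarmonic r k : ℚ) : K) = fieldHarmonic K r k := by
  have hshift := sum_Ico_add' (fun j : ℕ => 1 / (j : K) ^ r) 0 k 1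
  simp only [Nat.cast_add, Nat.cast_one] at hshift
  rw [genHarmonic, fieldHarmonic, range_eq_Ico, hshift]
  push_cast
  rfl

theorem binomialSum_cast {K : Type*} [Field K] [CharZero K] (r m : ℕ) :
    ((∑ k ∈ Icc 1 m, ((2 * k).choose k : ℚ) ^ 3 * genHarmonic r k / 64 ^ k : ℚ) : K)
      = ∑ k ∈ range (m + 1), hyperTerm (1 / 2) (1 / 2) k * fieldHarmonic K r k := by
  have hIcc : Icc 1 m = Ico (0 + 1) (m + 1) := rfl
  rw [sum_range_succ', fieldHarmonic_zero, mul_zero, add_zero, range_eq_Ico,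
    sum_Ico_add' (fun k => hyperTerm (1 / 2) (1 / 2) k * fieldHarmonic K r k) 0 m 1, hIcc]
  push_cast
  refine sum_congr rfl fun k _ => ?_
  rw [genHarmonic_cast, hyperTerm_half_half, centralRatio, Nat.centralBinom_eq_two_mul_choose,
    show (64 : K) = 4 ^ 3 by norm_num, pow_right_comm]
  ring

theorem binomialSum_congrMod {n : ℕ} (hn : p = 2 * n + 1) (r : ℕ) :
    ((∑ k ∈ Icc 1 (p - 1), ((2 * k).choose k : ℚ) ^ 3 * genHarmonic r k / 64 ^ k : ℚ) : ℚ_[p])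
      ≡[(p : ℚ_[p]) ^ 2] legendreSum ℚ_[p] (fieldHarmonic ℚ_[p] r) n := by
  rw [binomialSum_cast, legendreSum_eq_sum_range _ (show n < p - 1 + 1 by omega)]
  refine .sum fun k hk => ?_
  have hkp : k < p := by rw [mem_range] at hk; omega
  exact (hyperTerm_half_congrMod hn hkp).mul_right (fieldHarmonic_mem r hkp)

/-! ## Harmonic sums and Euler numbers modulo `p ^ 2` -/

theorem sum_range_add_reflect {A : Type*} [AddCommMonoid A] (f : ℕ → A) (m k : ℕ) :
    ∑ j ∈ range (m + k), f j = ∑ j ∈ range m, f j + ∑ i ∈ range k, f (m + (k - 1 - i)) := by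
  rw [sum_range_add, sum_range_reflect (fun i => f (m + i))]

theorem sum_range_two_mul {A : Type*} [AddCommMonoid A] (f : ℕ → A) (n : ℕ) :
    ∑ j ∈ range (2 * n), f j = ∑ i ∈ range n, f (2 * i) + ∑ i ∈ range n, f (2 * i + 1) := by
  induction n with
  | zero => simp
  | succ n ih =>
    rw [Nat.mul_succ, sum_range_succ, sum_range_succ, ih, sum_range_succ, sum_range_succ]
    abel

theorem one_div_reflect_congrMod (r : ℕ) {m i : ℕ} (hmi : m + i + 2 = p) :
    1 / ((m : ℚ_[p]) + 1) ^ r ≡[p] (-1) ^ r * (1 / ((i : ℚ_[p]) + 1) ^ r) := by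
  have hsum : (m : ℚ_[p]) + i + 2 = p := by exact_mod_cast congrArg (Nat.cast : ℕ → ℚ_[p]) hmi
  have hm : ‖(m : ℚ_[p]) + 1‖ = 1 := norm_natCast_add_one_eq_one (by omega)
  have hi : ‖-((i : ℚ_[p]) + 1)‖ = 1 := by
    rw [norm_neg, norm_natCast_add_one_eq_one (by omega)]
  have hmi' : (m : ℚ_[p]) + 1 ≡[p] -(i + 1) :=
    ⟨mem_of_norm_eq_one hm, mem_of_norm_eq_one hi, 1, one_mem 𝒪, by linear_combination hsum⟩
  have hsign : (-1) ^ r * (1 / ((i : ℚ_[p]) + 1) ^ r) = ((-((i : ℚ_[p]) + 1))⁻¹) ^ r := by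
    rw [inv_neg, neg_pow _⁻¹, inv_pow, one_div]
  rw [hsign, one_div, ← inv_pow]
  exact (hmi'.inv hm hi).pow r

theorem fieldHarmonic_reflect (r : ℕ) {m k : ℕ} (hmk : m + k + 1 = p) :
    fieldHarmonic ℚ_[p] r (p - 1)
      ≡[p] fieldHarmonic ℚ_[p] r m + (-1) ^ r * fieldHarmonic ℚ_[p] r k := by
  rw [show p - 1 = m + k by omega, fieldHarmonic, sum_range_add_reflect, fieldHarmonic,
    fieldHarmonic, mul_sum]
  refine .add (.refl (fieldHarmonic_mem r (by omega))) (.sum fun i hi => ?_)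
  rw [mem_range] at hi
  exact one_div_reflect_congrMod r (by omega)

theorem fieldHarmonic_one_full {n : ℕ} (hn : p = 2 * n + 1) :
    fieldHarmonic ℚ_[p] 1 (p - 1) ≡[p] 0 := by
  convert fieldHarmonic_reflect 1 (show n + n + 1 = p by omega) using 1
  ring

theorem fieldHarmonic_one_reflect {n m k : ℕ} (hn : p = 2 * n + 1) (hmk : m + k + 1 = p) :
    fieldHarmonic ℚ_[p] 1 m ≡[p] fieldHarmonic ℚ_[p] 1 k := by
  have hdiff := (fieldHarmonic_reflect 1 hmk).symm.trans (fieldHarmonic_one_full hn)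
  convert hdiff.add (.refl (fieldHarmonic_mem 1 (show k < p by omega))) using 1 <;> ring

theorem fieldHarmonic_two_mul {K : Type*} [Field K] (r n : ℕ) :
    fieldHarmonic K r (2 * n)
      = ∑ i ∈ range n, 1 / (2 * (i : K) + 1) ^ r + 1 / 2 ^ r * fieldHarmonic K r n := by
  rw [fieldHarmonic, sum_range_two_mul, fieldHarmonic, mul_sum]
  push_cast
  congr 1
  refine sum_congr rfl fun i _ => ?_
  rw [show 2 * (i : K) + 1 + 1 = 2 * (i + 1) by ring, mul_pow, one_div_mul_one_div]

theorem sum_one_div_odd_congrMod (r : ℕ) {n : ℕ} (hn : p = 2 * n + 1) :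
    ∑ i ∈ range n, 1 / (2 * (i : ℚ_[p]) + 1) ^ r
      ≡[p] (-1) ^ r * (1 / 2 ^ r * fieldHarmonic ℚ_[p] r n) := by
  rw [← sum_range_reflect, fieldHarmonic, mul_sum, mul_sum]
  refine .sum fun i hi => ?_
  rw [mem_range] at hi
  have h := one_div_reflect_congrMod (p := p) r
    (show 2 * (n - 1 - i) + (2 * i + 1) + 2 = p by omega)
  push_cast at h
  rwa [show 2 * (i : ℚ_[p]) + 1 + 1 = 2 * (i + 1) by ring, mul_pow, ← one_div_mul_one_div] at h

theorem fieldHarmonic_two_half (h3 : 3 < p) {n : ℕ} (hn : p = 2 * n + 1) :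
    fieldHarmonic ℚ_[p] 2 n ≡[p] 0 := by
  have hquarter : (1 / 2 ^ 2 : ℚ_[p]) ∈ 𝒪 :=
    div_mem_of_norm_eq_one (one_mem 𝒪) (by rw [norm_pow, norm_two_eq_one (by omega), one_pow])
  have hH := fieldHarmonic_mem (p := p) 2 (show n < p by omega)
  have hdouble := (sum_one_div_odd_congrMod 2 hn).add (.refl (mul_mem hquarter hH))
  rw [← fieldHarmonic_two_mul, show 2 * n = p - 1 by omega] at hdouble
  have htwice := hdouble.symm.trans (fieldHarmonic_reflect 2 (show n + n + 1 = p by omega))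
  have hthree : ‖(3 : ℚ_[p])‖ = 1 := by exact_mod_cast norm_natCast_eq_one three_ne_zero h3
  have hhalf := one_half_mem (p := p) (by omega)
  refine .of_mul_left hthree ?_
  convert ((htwice.sub (.refl (mul_mem hhalf hH))).mul_left (natCast_mem 𝒪 2)).symm using 1 <;>
  · push_cast
    ring

theorem two_pow_pred_eq : (2 : ℚ_[p]) ^ (p - 1) = 1 + p * qₚ := by
  have hp : (p : ℚ_[p]) ≠ 0 := Nat.cast_ne_zero.mpr (Fact.out : p.Prime).ne_zero
  rw [fermatQuotient]
  push_cast
  field_simp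
  ring

theorem natCast_pow_card_sub_one_congrMod {j : ℕ} (hj : ‖(j : ℚ_[p])‖ = 1) :
    (j : ℚ_[p]) ^ (p - 1) ≡[p] 1 := by
  have hcoprime : IsCoprime (j : ℤ) p :=
    Nat.isCoprime_iff_coprime.mpr (Padic.norm_natCast_eq_one_iff.mp hj).symm
  obtain ⟨z, hz⟩ := Int.modEq_iff_dvd.mp
    (Int.ModEq.pow_card_sub_one_eq_one (Fact.out : p.Prime) hcoprime).symm
  exact ⟨pow_mem (natCast_mem 𝒪 j) _, one_mem 𝒪, z, intCast_mem 𝒪 z, by exact_mod_cast hz⟩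

theorem fermatQuotient_mem (hp : p ≠ 2) : qₚ ∈ 𝒪 := by
  have hp0 : (p : ℚ_[p]) ≠ 0 := Nat.cast_ne_zero.mpr (Fact.out : p.Prime).ne_zero
  obtain ⟨-, -, z, hz, heq⟩ := natCast_pow_card_sub_one_congrMod (norm_two_eq_one hp)
  rw [Nat.cast_two, two_pow_pred_eq, add_sub_cancel_left] at heq
  rwa [mul_left_cancel₀ hp0 heq]

theorem sum_one_div_one_add {K : Type*} [Field K] (k : ℕ) :
    ∑ j ∈ range k, 1 / (1 + (j : K)) = fieldHarmonic K 1 k := by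
  simp only [fieldHarmonic, pow_one, add_comm]

theorem hasSlope_rising_one_sub {t : ℚ_[p]} (ht : t ∈ 𝒪) {k : ℕ} (hk : k < p) :
    HasSlope 𝒪 p (rising (1 - p * t) k / k.factorial) (-(t * fieldHarmonic ℚ_[p] 1 k)) := by
  have h := hasSlope_rising_div_rising (x := 1) (y := -t) (n := k) (natCast_mem 𝒪 p) (neg_mem ht)
    fun j hj => by rw [add_comm, norm_natCast_add_one_eq_one (by omega)]
  rwa [rising_one, mul_neg, ← sub_eq_add_neg, neg_mul, sum_one_div_one_add] at h

theorem factorial_pred_eq {m k : ℕ} (hmk : m + k + 1 = p) :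
    ((p - 1).factorial : ℚ_[p]) = (-1) ^ k * m.factorial * rising (1 - (p : ℚ_[p])) k := by
  have hp : (p : ℚ_[p]) = m + k + 1 := by exact_mod_cast congrArg (Nat.cast : ℕ → ℚ_[p]) hmk.symm
  rw [show p - 1 = m + k by omega, ← factorial_mul_rising_natCast_add_one, rising_reflect,
    show 1 - ((m : ℚ_[p]) + 1) - k = 1 - p by rw [hp]; ring]
  ring

theorem hasSlope_factorial_pred {m k : ℕ} (hmk : m + k + 1 = p) :
    HasSlope 𝒪 p ((p - 1).factorial / ((-1) ^ k * m.factorial * k.factorial))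
      (-fieldHarmonic ℚ_[p] 1 k) := by
  have h := hasSlope_rising_one_sub (one_mem 𝒪) (show k < p by omega)
  rw [mul_one, one_mul] at h
  have hm : (m.factorial : ℚ_[p]) ≠ 0 := Nat.cast_ne_zero.mpr m.factorial_ne_zero
  rwa [factorial_pred_eq hmk, mul_div_mul_left _ _ (mul_ne_zero (pow_ne_zero k (by norm_num)) hm)]

theorem choose_pred_congrMod {k : ℕ} (hk : k < p) : ((p - 1).choose k : ℚ_[p]) ≡[p] (-1) ^ k := by
  have hfact : (k.factorial : ℚ_[p]) ≠ 0 := Nat.cast_ne_zero.mpr k.factorial_ne_zero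
  have hp : -((p - 1 : ℕ) : ℚ_[p]) = 1 - p * 1 := by
    rw [Nat.cast_sub (by omega), Nat.cast_one]
    ring
  have h := (hasSlope_rising_one_sub (one_mem 𝒪) hk).congrMod_one (natCast_mem 𝒪 p)
  rw [← hp, rising_neg_natCast, ← mul_assoc, mul_div_cancel_right₀ _ hfact] at h
  have h' := h.mul_left (pow_mem (neg_mem (one_mem 𝒪)) k)
  rwa [← mul_assoc, ← mul_pow, neg_one_mul, neg_neg, one_pow, one_mul, mul_one] at h'

theorem succ_mul_sum_choose_div_succ {K : Type*} [Field K] [CharZero K] (m : ℕ) :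
    ((m : K) + 1) * ∑ k ∈ range m, (m.choose k : K) / (k + 1) = 2 * (2 ^ m - 1) := by
  have hterm : ∀ k : ℕ, ((m : K) + 1) * (m.choose k / (k + 1)) = (m + 1).choose (k + 1) := by
    intro k
    rw [mul_div_assoc', div_eq_iff k.cast_add_one_ne_zero]
    exact_mod_cast Nat.add_one_mul_choose_eq m k
  have hrow : ∑ k ∈ range (m + 2), ((m + 1).choose k : K) = 2 ^ (m + 1) := by
    exact_mod_cast congrArg (Nat.cast : ℕ → K) (Nat.sum_range_choose (m + 1))
  rw [sum_range_succ', sum_range_succ, Nat.choose_self, Nat.choose_zero_right] at hrow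
  simp only [mul_sum, hterm]
  push_cast at hrow
  linear_combination hrow

theorem alternatingHarmonic_full :
    ∑ k ∈ range (p - 1), (-1) ^ k / ((k : ℚ_[p]) + 1) ≡[p] 2 * qₚ := by
  have hp0 : (p : ℚ_[p]) ≠ 0 := Nat.cast_ne_zero.mpr (Fact.out : p.Prime).ne_zero
  have hpred : ((p - 1 : ℕ) : ℚ_[p]) + 1 = p := by
    exact_mod_cast Nat.sub_add_cancel (Fact.out : p.Prime).one_le
  have hchoose : ∑ k ∈ range (p - 1), ((p - 1).choose k : ℚ_[p]) / (k + 1) = 2 * qₚ := by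
    have hsum := succ_mul_sum_choose_div_succ (K := ℚ_[p]) (p - 1)
    rw [two_pow_pred_eq, hpred] at hsum
    exact mul_left_cancel₀ hp0 (by linear_combination hsum)
  rw [← hchoose]
  refine .sum fun k hk => ?_
  rw [mem_range] at hk
  rw [div_eq_mul_inv, div_eq_mul_inv]
  exact (choose_pred_congrMod (by omega)).symm.mul_right
    (inv_mem_of_norm_eq_one (norm_natCast_add_one_eq_one (by omega)))

theorem alternatingHarmonic_half {n : ℕ} (hn : p = 2 * n + 1) :
    ∑ k ∈ range n, (-1) ^ k / ((k : ℚ_[p]) + 1) ≡[p] qₚ := by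
  have hreflect : ∑ i ∈ range n, (-1) ^ (n + (n - 1 - i)) / (((n + (n - 1 - i) : ℕ) : ℚ_[p]) + 1)
      ≡[p] ∑ k ∈ range n, (-1) ^ k / ((k : ℚ_[p]) + 1) := by
    refine .sum fun i hi => ?_
    rw [mem_range] at hi
    have hterm := (one_div_reflect_congrMod (p := p) 1
      (show n + (n - 1 - i) + i + 2 = p by omega)).mul_left
        (pow_mem (neg_mem (one_mem 𝒪)) (n + (n - 1 - i)))
    have hsign : (-1 : ℚ_[p]) ^ (n + (n - 1 - i)) * (-1) ^ 1 = (-1) ^ i := by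
      rw [← pow_add, neg_one_pow_congr]
      grind
    rwa [← mul_assoc, hsign, mul_one_div, mul_one_div, pow_one, pow_one] at hterm
  have hfull := alternatingHarmonic_full (p := p)
  rw [show p - 1 = n + n by omega, sum_range_add_reflect] at hfull
  refine .of_mul_left (norm_two_eq_one (p := p) (by omega)) ?_
  rw [two_mul]
  exact ((CongrMod.refl hreflect.right_mem).add hreflect.symm).trans hfull

theorem fieldHarmonic_sub_alternating {K : Type*} [Field K] [NeZero (2 : K)] (m : ℕ) :
    fieldHarmonic K 1 (2 * m) - ∑ k ∈ range (2 * m), (-1) ^ k / ((k : K) + 1)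
      = fieldHarmonic K 1 m := by
  have hterm : ∀ i : ℕ, (-1) ^ (2 * i + 1) / (((2 * i + 1 : ℕ) : K) + 1)
      = -(1 / 2 * (1 / ((i : K) + 1) ^ 1)) := by
    intro i
    rw [pow_succ, pow_mul, neg_one_sq, one_pow, one_mul, pow_one, one_div_mul_one_div, neg_div]
    push_cast
    ring
  rw [fieldHarmonic_two_mul, sum_range_two_mul]
  simp only [hterm, sum_neg_distrib, ← mul_sum, pow_one, pow_mul, neg_one_sq, one_pow,
    Nat.cast_mul, Nat.cast_two]
  rw [fieldHarmonic]
  simp only [pow_one]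
  have h2 : (2 : K) ≠ 0 := NeZero.ne 2
  field_simp
  ring

theorem fieldHarmonic_quarter {n m : ℕ} (hn : p = 2 * n + 1) (hm : n = 2 * m ∨ n = 2 * m + 1) :
    fieldHarmonic ℚ_[p] 1 m ≡[p] fieldHarmonic ℚ_[p] 1 n - qₚ := by
  have hsplit : fieldHarmonic ℚ_[p] 1 n - ∑ k ∈ range n, (-1) ^ k / ((k : ℚ_[p]) + 1)
      = fieldHarmonic ℚ_[p] 1 m := by
    rw [← fieldHarmonic_sub_alternating m]
    rcases hm with rfl | rfl
    · rfl
    · rw [fieldHarmonic_succ, sum_range_succ, pow_mul, neg_one_sq, one_pow, pow_one]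
      ring
  rw [← hsplit]
  exact (CongrMod.refl (fieldHarmonic_mem 1 (by omega))).sub (alternatingHarmonic_half hn)

theorem rising_neg_two_mul {K : Type*} [Field K] [CharZero K] (n : ℕ) :
    rising (-((2 * n : ℕ) : K)) n = 4 ^ n * rising (1 / 2 - n : K) n := by
  have hhalf := rising_reflect (1 / 2 - n : K) n
  rw [show 1 - (1 / 2 - (n : K)) - n = 1 / 2 by ring, rising_half, centralRatio] at hhalf
  rw [hhalf, rising_neg_natCast, ← Nat.centralBinom_eq_two_mul_choose]
  field_simp

/-- No `H^{(2)}` term survives at order `p²`, because `H^{(2)}_{(p-1)/2}` is divisible by `p`. -/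
theorem rising_one_sub_congrMod_cube (h3 : 3 < p) {n : ℕ} (hn : p = 2 * n + 1) {t : ℚ_[p]}
    (ht : t ∈ 𝒪) :
    rising (1 - p * t) n / n.factorial ≡[(p : ℚ_[p]) ^ 3]
      1 - p * (t * fieldHarmonic ℚ_[p] 1 n)
        + p ^ 2 * (1 / 2 * (t * fieldHarmonic ℚ_[p] 1 n) ^ 2) := by
  have hhalf := one_half_mem (p := p) (by omega)
  have hsum : ∑ j ∈ range n, -t * (1 / (1 + (j : ℚ_[p]))) = -(t * fieldHarmonic ℚ_[p] 1 n) := by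
    rw [← mul_sum, sum_one_div_one_add, neg_mul]
  have hsumsq : ∑ j ∈ range n, (-t * (1 / (1 + (j : ℚ_[p])))) ^ 2
      = t ^ 2 * fieldHarmonic ℚ_[p] 2 n := by
    simp only [fieldHarmonic, mul_sum, mul_pow, neg_sq, one_div_pow, add_comm]
  have hexpand := prod_one_add_mul_congrMod_cube (natCast_mem 𝒪 p) hhalf (s := range n)
    (f := fun j => -t * (1 / (1 + (j : ℚ_[p])))) fun j hj => by
      rw [mem_range] at hj
      refine mul_mem (neg_mem ht) (div_mem_of_norm_eq_one (one_mem 𝒪) ?_)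
      rw [add_comm, norm_natCast_add_one_eq_one (by omega)]
  rw [hsum, hsumsq] at hexpand
  have hprod := rising_add_div_rising (x := (1 : ℚ_[p])) (n := n)
    (fun j _ => by rw [add_comm]; exact j.cast_add_one_ne_zero) (p * -t)
  rw [rising_one, mul_neg, ← sub_eq_add_neg] at hprod
  obtain ⟨hl, -, u, hu, heq⟩ := hexpand
  obtain ⟨-, -, v, hv, hH2⟩ := fieldHarmonic_two_half h3 hn
  have hH := fieldHarmonic_mem (p := p) 1 (show n < p by omega)
  have hpmem := natCast_mem 𝒪 p
  rw [hprod]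
  refine ⟨?_, ?_, u - 1 / 2 * t ^ 2 * v, ?_, ?_⟩
  · simpa only [mul_neg, neg_mul, mul_assoc] using hl
  · apply_rules [add_mem, sub_mem, mul_mem, pow_mem, one_mem]
  · apply_rules [sub_mem, mul_mem, pow_mem]
  · simp only [mul_neg, neg_mul, mul_assoc] at heq ⊢
    linear_combination heq - (p : ℚ_[p]) ^ 2 * (1 / 2 * t ^ 2) * hH2

/-- Compares the second-order expansions of `(1 - p)_n` and `4ⁿ (1 - p / 2)_n`. -/
theorem fieldHarmonic_half_implicit (h3 : 3 < p) {n : ℕ} (hn : p = 2 * n + 1) :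
    fieldHarmonic ℚ_[p] 1 n ≡[(p : ℚ_[p]) ^ 2]
      -2 * qₚ + p * (3 * (1 / 2) * (1 / 2) * fieldHarmonic ℚ_[p] 1 n ^ 2
        + qₚ * fieldHarmonic ℚ_[p] 1 n) := by
  have hpn : (p : ℚ_[p]) = 2 * n + 1 := by exact_mod_cast congrArg (Nat.cast : ℕ → ℚ_[p]) hn
  have hp0 : (p : ℚ_[p]) ≠ 0 := Nat.cast_ne_zero.mpr (by omega)
  have hpmem := natCast_mem 𝒪 p
  have h2mem : (2 : ℚ_[p]) ∈ 𝒪 := by exact_mod_cast natCast_mem 𝒪 2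
  have h3mem : (3 : ℚ_[p]) ∈ 𝒪 := by exact_mod_cast natCast_mem 𝒪 3
  have hhalf := one_half_mem (p := p) (by omega)
  have hq := fermatQuotient_mem (p := p) (by omega)
  have hH := fieldHarmonic_mem (p := p) 1 (show n < p by omega)
  have hduplication : rising (1 - (p : ℚ_[p]) * 1) n / n.factorial
      = (1 + p * qₚ) * (rising (1 - (p : ℚ_[p]) * (1 / 2)) n / n.factorial) := by
    rw [show 1 - (p : ℚ_[p]) * 1 = -((2 * n : ℕ) : ℚ_[p]) by rw [hpn]; push_cast; ring,
      show 1 - (p : ℚ_[p]) * (1 / 2) = 1 / 2 - n by rw [hpn]; ring, rising_neg_two_mul,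
      ← two_pow_pred_eq, show p - 1 = 2 * n by omega, pow_mul, mul_div_assoc]
    norm_num
  have hcompare := (rising_one_sub_congrMod_cube h3 hn (one_mem 𝒪)).symm.trans
    (hduplication ▸ (rising_one_sub_congrMod_cube h3 hn hhalf).mul_left
      (add_mem (one_mem 𝒪) (mul_mem hpmem hq)))
  obtain ⟨-, -, u, hu, heq⟩ := hcompare
  generalize fieldHarmonic ℚ_[p] 1 n = H at *
  refine ⟨hH, ?_, -2 * u - 1 / 2 * (1 / 2) * qₚ * H ^ 2, ?_, mul_left_cancel₀ hp0 ?_⟩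
  · apply_rules [add_mem, mul_mem, pow_mem, neg_mem]
  · apply_rules [sub_mem, mul_mem, pow_mem, neg_mem]
  · linear_combination -2 * heq

theorem fieldHarmonic_half (h3 : 3 < p) {n : ℕ} (hn : p = 2 * n + 1) :
    fieldHarmonic ℚ_[p] 1 n ≡[(p : ℚ_[p]) ^ 2] -2 * qₚ + p * qₚ ^ 2 := by
  have hpmem := natCast_mem 𝒪 p
  have h2mem : (2 : ℚ_[p]) ∈ 𝒪 := by exact_mod_cast natCast_mem 𝒪 2
  have h3mem : (3 : ℚ_[p]) ∈ 𝒪 := by exact_mod_cast natCast_mem 𝒪 3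
  have hhalf := one_half_mem (p := p) (by omega)
  have hq := fermatQuotient_mem (p := p) (by omega)
  have hH := fieldHarmonic_mem (p := p) 1 (show n < p by omega)
  have hfirst : fieldHarmonic ℚ_[p] 1 n ≡[p] -2 * qₚ :=
    (fieldHarmonic_half_implicit h3 hn).of_sq.trans
      (.add_mul_self (mul_mem (neg_mem h2mem) hq) hpmem
        (add_mem (mul_mem (mul_mem (mul_mem h3mem hhalf) hhalf) (pow_mem hH 2)) (mul_mem hq hH)))
  have hcorrection : 3 * (1 / 2) * (1 / 2) * fieldHarmonic ℚ_[p] 1 n ^ 2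
      + qₚ * fieldHarmonic ℚ_[p] 1 n ≡[p] qₚ ^ 2 := by
    convert ((hfirst.pow 2).mul_left (mul_mem (mul_mem h3mem hhalf) hhalf)).add
      (hfirst.mul_left hq) using 1
    ring
  exact (fieldHarmonic_half_implicit h3 hn).trans
    ((CongrMod.refl (mul_mem (neg_mem h2mem) hq)).add (hcorrection.scale_self hpmem))

open Polynomial in
/-- The linear functional on polynomials with `X ^ i ↦ E_i`, through which the umbral calculus of
Euler numbers is carried out. -/
noncomputable def eulerFunctional : ℤ[X] →ₗ[ℤ] ℤ :=
  (Polynomial.basisMonomials ℤ).constr ℤ eulerNumber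

open Polynomial in
theorem eulerFunctional_X_pow (i : ℕ) : eulerFunctional (X ^ i) = eulerNumber i := by
  have h := (Polynomial.basisMonomials ℤ).constr_basis ℤ eulerNumber i
  simpa only [eulerFunctional, Polynomial.coe_basisMonomials,
    Polynomial.monomial_one_right_eq_X_pow] using h

open Polynomial in
theorem eulerFunctional_X_add_C_pow (t : ℤ) (m : ℕ) :
    eulerFunctional ((X + C t) ^ m)
      = ∑ i ∈ range (m + 1), t ^ (m - i) * (m.choose i : ℤ) * eulerNumber i := by
  rw [add_pow, map_sum]
  refine sum_congr rfl fun i _ => ?_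
  have hsmul : X ^ i * C t ^ (m - i) * (m.choose i : ℤ[X])
      = (t ^ (m - i) * (m.choose i : ℤ)) • X ^ i := by
    rw [Polynomial.smul_eq_C_mul]
    simp only [map_mul, map_pow, map_natCast]
    ring
  rw [hsmul, map_smul, eulerFunctional_X_pow, smul_eq_mul]

open Polynomial in
theorem eulerFunctional_shift (P : ℤ[X]) :
    eulerFunctional (P.comp (X + C 1)) + eulerFunctional (P.comp (X + C (-1))) = 2 * P.eval 0 := by
  induction P using Polynomial.induction_on' with
  | add P Q hP hQ =>
    simp only [Polynomial.add_comp, map_add, Polynomial.eval_add]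
    linear_combination hP + hQ
  | monomial n a =>
    have hsum : ∑ i ∈ range (n + 1), ((1 : ℤ) ^ (n - i) * (n.choose i : ℤ) * eulerNumber i
        + (-1) ^ (n - i) * (n.choose i : ℤ) * eulerNumber i) = 2 * if n = 0 then 1 else 0 := by
      rw [← eulerNumber_recurrence n, mul_sum]
      refine sum_congr rfl fun i _ => ?_
      split_ifs with heven
      · rw [heven.neg_one_pow, one_pow]
        ring
      · rw [(Nat.not_even_iff_odd.mp heven).neg_one_pow, one_pow]
        ring
    simp only [Polynomial.monomial_comp, ← Polynomial.smul_eq_C_mul, map_smul,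
      eulerFunctional_X_add_C_pow, Polynomial.eval_monomial, smul_eq_mul]
    rw [← mul_add, ← sum_add_distrib, hsum, zero_pow_eq]
    ring

open Polynomial in
theorem eulerFunctional_add_pow (t : ℤ) (m : ℕ) :
    eulerFunctional ((X + C (t + 1)) ^ m) + eulerFunctional ((X + C (t - 1)) ^ m) = 2 * t ^ m := by
  have h := eulerFunctional_shift ((X + C t) ^ m)
  simp only [Polynomial.pow_comp, Polynomial.add_comp, Polynomial.X_comp, Polynomial.C_comp,
    Polynomial.eval_pow, Polynomial.eval_add, Polynomial.eval_X, Polynomial.eval_C, zero_add] at h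
  rwa [add_assoc, add_assoc, ← C_add, ← C_add, add_comm 1, neg_add_eq_sub] at h

theorem eulerNumber_odd {n : ℕ} (hn : Odd n) : eulerNumber n = 0 := by
  induction n using Nat.strong_induction_on with
  | _ n ih =>
    have h := eulerNumber_recurrence n
    rw [if_neg (by rintro rfl; simp at hn), sum_range_succ, sum_eq_zero] at h
    · simpa using h
    · intro k hk
      rw [mem_range] at hk
      split_ifs with heven
      · rw [ih k hk (by grind), mul_zero]
      · rfl

open Polynomial in
theorem eulerFunctional_X_add_one_pow {m : ℕ} (hm : Even m) (hm0 : m ≠ 0) :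
    eulerFunctional ((X + C 1) ^ m) = 0 := by
  have h := eulerNumber_recurrence m
  rw [if_neg hm0] at h
  rw [eulerFunctional_X_add_C_pow, ← h]
  refine sum_congr rfl fun i hi => ?_
  rw [mem_range] at hi
  split_ifs with heven
  · simp
  · rw [eulerNumber_odd (by grind), mul_zero]

open Polynomial in
theorem two_mul_alternating_pow_sum {m : ℕ} (hm : Even m) (hm0 : m ≠ 0) (n : ℕ) :
    2 * ∑ j ∈ range n, (-1) ^ (j + 1) * (2 * ((j : ℤ) + 1)) ^ m
      = (-1) ^ n * eulerFunctional ((X + C (2 * (n : ℤ) + 1)) ^ m) := by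
  induction n with
  | zero => simpa using (eulerFunctional_X_add_one_pow hm hm0).symm
  | succ n ih =>
    have h := eulerFunctional_add_pow (2 * ((n : ℤ) + 1)) m
    rw [show 2 * ((n : ℤ) + 1) - 1 = 2 * n + 1 by ring] at h
    rw [sum_range_succ, mul_add, ih, pow_succ]
    push_cast
    linear_combination (-1) ^ n * h

open Polynomial in
/-- The term linear in `t` vanishes, because the Euler number of index `m - 1` does. -/
theorem sq_dvd_eulerFunctional_X_add_C_pow_sub (t : ℤ) {m : ℕ} (hm : Even m) (hm0 : m ≠ 0) :
    t ^ 2 ∣ eulerFunctional ((X + C t) ^ m) - eulerNumber m := by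
  obtain ⟨k, rfl⟩ : ∃ k, m = k + 2 := ⟨m - 2, by grind⟩
  rw [eulerFunctional_X_add_C_pow, sum_range_succ, sum_range_succ,
    eulerNumber_odd (show Odd (k + 1) by grind)]
  simp only [Nat.sub_self, pow_zero, Nat.choose_self, Nat.cast_one, one_mul, mul_zero, add_zero,
    add_sub_cancel_right]
  refine dvd_sum fun i hi => ?_
  rw [mem_range] at hi
  rw [show k + 2 - i = (k - i) + 2 by omega, pow_add, mul_assoc, mul_assoc]
  exact (dvd_mul_right _ _).mul_left _

theorem two_mul_alternating_pow_sum_congrMod {n m : ℕ} (hn : p = 2 * n + 1) (hne : Even n)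
    (hm : Even m) (hm0 : m ≠ 0) :
    2 * ∑ j ∈ range n, (-1) ^ (j + 1) * (2 * ((j : ℚ_[p]) + 1)) ^ m
      ≡[(p : ℚ_[p]) ^ 2] eulerNumber m := by
  obtain ⟨z, hz⟩ := sq_dvd_eulerFunctional_X_add_C_pow_sub (p : ℤ) hm hm0
  have hsum := two_mul_alternating_pow_sum hm hm0 n
  rw [hne.neg_one_pow, one_mul, show 2 * (n : ℤ) + 1 = p by exact_mod_cast hn.symm] at hsum
  rw [← hsum] at hz
  have hcast : 2 * ∑ j ∈ range n, (-1) ^ (j + 1) * (2 * ((j : ℚ_[p]) + 1)) ^ m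
      = ((2 * ∑ j ∈ range n, (-1) ^ (j + 1) * (2 * ((j : ℤ) + 1)) ^ m : ℤ) : ℚ_[p]) := by
    push_cast
    rfl
  rw [hcast]
  exact ⟨intCast_mem 𝒪 _, intCast_mem 𝒪 _, z, intCast_mem 𝒪 z, by exact_mod_cast hz⟩

/-- With `x^(p-1) = 1 + p z` one has `1 - 2 x^(p-1) + x^(2p-2) = (p z)²`. -/
theorem inv_sq_congrMod {x : ℚ_[p]} (hp : p ≠ 2) (hx : ‖x‖ = 1) (hpow : x ^ (p - 1) ≡[p] 1) :
    (x ^ 2)⁻¹ ≡[(p : ℚ_[p]) ^ 2] 2 * x ^ (p - 3) - x ^ (2 * p - 4) := by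
  have htwo := (Fact.out : p.Prime).two_le
  have hx0 := ne_zero_of_norm_eq_one hx
  have hmem := mem_of_norm_eq_one hx
  obtain ⟨-, -, z, hz, heq⟩ := hpow
  have hxsq := inv_mem_of_norm_eq_one (x := x ^ 2) (by rw [norm_pow, hx, one_pow])
  refine ⟨hxsq, ?_, z ^ 2 * (x ^ 2)⁻¹, mul_mem (pow_mem hz 2) hxsq, ?_⟩
  · exact sub_mem (mul_mem (by exact_mod_cast natCast_mem 𝒪 2) (pow_mem hmem _)) (pow_mem hmem _)
  · rw [show p - 1 = (p - 3) + 2 by omega, pow_add] at heq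
    rw [show 2 * p - 4 = (p - 3) + (p - 3) + 2 by omega, pow_add, pow_add]
    field_simp
    linear_combination (x ^ (p - 3) * x ^ 2 - 1 + p * z) * heq

theorem alternating_inv_sq_congrMod (h3 : 3 < p) {n : ℕ} (hn : p = 2 * n + 1) (hne : Even n) :
    ∑ j ∈ range n, (-1) ^ (j + 1) / ((j : ℚ_[p]) + 1) ^ 2 ≡[(p : ℚ_[p]) ^ 2]
      4 * eulerNumber (p - 3) - 2 * eulerNumber (2 * p - 4) := by
  have htwo := norm_two_eq_one (p := p) (by omega)
  have hfour : (4 : ℚ_[p]) ∈ 𝒪 := by exact_mod_cast natCast_mem 𝒪 4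
  have hsum : ∑ j ∈ range n, (-1) ^ (j + 1) * ((2 * ((j : ℚ_[p]) + 1)) ^ 2)⁻¹
      ≡[(p : ℚ_[p]) ^ 2] ∑ j ∈ range n, (-1) ^ (j + 1) *
        (2 * (2 * ((j : ℚ_[p]) + 1)) ^ (p - 3) - (2 * ((j : ℚ_[p]) + 1)) ^ (2 * p - 4)) := by
    refine .sum fun j hj => ?_
    rw [mem_range] at hj
    have hnorm : ‖2 * ((j : ℚ_[p]) + 1)‖ = 1 := by
      rw [norm_mul, htwo, norm_natCast_add_one_eq_one (by omega), one_mul]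
    have hcast : ((2 * (j + 1) : ℕ) : ℚ_[p]) = 2 * (j + 1) := by push_cast; rfl
    refine (inv_sq_congrMod (by omega) hnorm ?_).mul_left (pow_mem (neg_mem (one_mem 𝒪)) _)
    rw [← hcast] at hnorm ⊢
    exact natCast_pow_card_sub_one_congrMod hnorm
  have hfirst := two_mul_alternating_pow_sum_congrMod hn hne (show Even (p - 3) by grind)
    (by grind)
  have hsecond := two_mul_alternating_pow_sum_congrMod hn hne (show Even (2 * p - 4) by grind)
    (by omega)
  have hinv : ∑ j ∈ range n, (-1) ^ (j + 1) / ((j : ℚ_[p]) + 1) ^ 2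
      = 4 * ∑ j ∈ range n, (-1) ^ (j + 1) * ((2 * ((j : ℚ_[p]) + 1)) ^ 2)⁻¹ := by
    rw [mul_sum]
    refine sum_congr rfl fun j _ => ?_
    rw [mul_pow, mul_inv]
    ring
  simp only [mul_sub, sum_sub_distrib, mul_left_comm _ (2 : ℚ_[p]), ← mul_sum] at hsum
  rw [hinv]
  refine (hsum.mul_left hfour).trans ?_
  convert (hfirst.mul_left hfour).sub (hsecond.mul_left (mem_of_norm_eq_one htwo)) using 1
  ring

/-! ## Morita's product at `1 / 4` -/

theorem congrMod_of_norm_sub_le {c x y : ℚ_[p]} (hx : x ∈ 𝒪) (hy : y ∈ 𝒪)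
    (h : ‖x - y‖ ≤ ‖c‖) : x ≡[c] y := by
  refine ⟨hx, hy, (x - y) / c, ?_, (mul_div_cancel_of_imp' fun hc => ?_).symm⟩
  · rw [PadicInt.mem_subring_iff, norm_div]
    exact div_le_one_of_le₀ h (norm_nonneg c)
  · rwa [hc, norm_zero, norm_le_zero_iff] at h

theorem CongrMod.padicCongr {r : ℕ} {x y : ℚ_[p]} : x ≡[(p : ℚ_[p]) ^ r] y → PadicCongr p r x y :=
  fun ⟨_, _, z, hz, h⟩ => ⟨⟨z, hz⟩, h⟩

theorem padicGamma_congrMod_moritaSeq (hp : p ≠ 2) {c : ℚ_[p]} {x : ℤ_[p]} {N : ℕ}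
    (h : (x : ℚ_[p]) ≡[c] N) : (padicGamma p x : ℚ_[p]) ≡[c] moritaSeq p N := by
  obtain ⟨-, -, z, hz, hxN⟩ := h
  refine congrMod_of_norm_sub_le (padicGamma p x).2 (intCast_mem 𝒪 _) ?_
  have hdist := padicGamma_dist_natCast p hp x N
  rw [dist_eq_norm, dist_eq_norm, PadicInt.norm_def, PadicInt.norm_def] at hdist
  push_cast at hdist
  calc ‖(padicGamma p x : ℚ_[p]) - moritaSeq p N‖ ≤ ‖c * z‖ := by rwa [← hxN]
    _ ≤ ‖c‖ := by
      rw [norm_mul]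
      exact mul_le_of_le_one_right (norm_nonneg c) ((PadicInt.mem_subring_iff p).mp hz)

theorem padicGamma_quarter_congrMod (h3 : 3 < p) {N : ℕ} (hN : 4 * N = 1 + 3 * p ^ 2) :
    (padicGamma p (padicQuarter p h3) : ℚ_[p]) ≡[(p : ℚ_[p]) ^ 2] moritaSeq p N := by
  refine padicGamma_congrMod_moritaSeq (by omega)
    ⟨(padicQuarter p h3).2, natCast_mem 𝒪 N, -(3 * (padicQuarter p h3 : ℚ_[p])),
      neg_mem (mul_mem (ofNat_mem 𝒪 3) (padicQuarter p h3).2), ?_⟩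
  have hquarter : (padicQuarter p h3 : ℚ_[p]) = 1 / 4 := rfl
  have hN' : (4 : ℚ_[p]) * N = 1 + 3 * (p : ℚ_[p]) ^ 2 := by exact_mod_cast hN
  rw [hquarter]
  linear_combination -(1 / 4) * hN'

/-- The `k`-th factor of Morita's product, with the multiples of `p` replaced by `1`, so that the
product over an interval can be split at the multiples of `p`. -/
def coprimeFactor (p k : ℕ) : ℕ := if k.Coprime p then k else 1

theorem moritaSeq_eq (p N : ℕ) :
    moritaSeq p N = (-1) ^ N * ∏ k ∈ range N, (coprimeFactor p k : ℤ) := by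
  rw [moritaSeq, prod_filter]
  congr 1
  refine prod_congr rfl fun k _ => ?_
  rw [coprimeFactor]
  split_ifs <;> simp

theorem prod_coprimeFactor_block {K : Type*} [CommRing K] (Q : ℕ) {R : ℕ} (hR : R < p) :
    ∏ x ∈ range (R + 1), (coprimeFactor p (p * Q + x) : K) = rising ((1 : K) + p * Q) R := by
  have hprime : p.Prime := Fact.out
  have hfirst : coprimeFactor p (p * Q + 0) = 1 := by
    rw [coprimeFactor, if_neg]
    rw [add_zero, Nat.coprime_comm, hprime.coprime_iff_not_dvd, not_not]
    exact Nat.dvd_mul_right p Q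
  rw [prod_range_succ', hfirst, Nat.cast_one, mul_one, rising_eq_prod]
  refine prod_congr rfl fun x hx => ?_
  rw [mem_range] at hx
  rw [coprimeFactor, if_pos]
  · push_cast
    ring
  · rw [Nat.coprime_comm, hprime.coprime_iff_not_dvd,
      ← Nat.dvd_add_iff_right (Nat.dvd_mul_right p Q)]
    exact Nat.not_dvd_of_pos_of_lt x.succ_pos (by omega)

theorem hasSlope_rising_one_add (Q : ℕ) {R : ℕ} (hR : R < p) :
    HasSlope 𝒪 p (rising (1 + (p : ℚ_[p]) * Q) R / R.factorial) (Q * fieldHarmonic ℚ_[p] 1 R) := by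
  rw [← rising_one, ← sum_one_div_one_add]
  refine hasSlope_rising_div_rising (natCast_mem 𝒪 p) (natCast_mem 𝒪 Q) fun j hj => ?_
  rw [add_comm]
  exact norm_natCast_add_one_eq_one (by omega)

theorem prod_coprimeFactor_blocks {n : ℕ} (hn : p = 2 * n + 1) (Q : ℕ) :
    ∏ x ∈ range (p * Q), (coprimeFactor p x : ℚ_[p]) ≡[(p : ℚ_[p]) ^ 2]
      ((p - 1).factorial : ℚ_[p]) ^ Q := by
  induction Q with
  | zero => simpa using CongrMod.refl (one_mem 𝒪)
  | succ Q ih =>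
    have hlt : p - 1 < p := by omega
    have hblock := prod_coprimeFactor_block (K := ℚ_[p]) Q hlt
    rw [show p - 1 + 1 = p by omega] at hblock
    have hslope : (Q : ℚ_[p]) * fieldHarmonic ℚ_[p] 1 (p - 1) ≡[p] 0 := by
      simpa using (fieldHarmonic_one_full hn).mul_left (natCast_mem 𝒪 Q)
    have hone := (hasSlope_rising_one_add Q hlt).congrMod_sq_one (natCast_mem 𝒪 p) hslope
    rw [Nat.mul_succ, prod_range_add, hblock,
      pow_succ ((p - 1).factorial : ℚ_[p])]
    refine ih.mul ?_
    have hfact := ne_zero_of_norm_eq_one (norm_factorial_eq_one hlt)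
    simpa only [div_mul_cancel₀ _ hfact, one_mul] using
      hone.mul_right (natCast_mem 𝒪 (p - 1).factorial)

theorem moritaSeq_pow_four_congrMod {n : ℕ} (hn : p = 2 * n + 1) (Q : ℕ) {R : ℕ} (hR : R < p) :
    (moritaSeq p (p * Q + (R + 1)) : ℚ_[p]) ^ 4 ≡[(p : ℚ_[p]) ^ 2]
      ((p - 1).factorial ^ Q * rising (1 + (p : ℚ_[p]) * Q) R) ^ 4 := by
  have hsign (N : ℕ) : (((-1) ^ N) ^ 4 : ℚ_[p]) = 1 := by
    rw [pow_right_comm, Even.neg_one_pow (by decide), one_pow]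
  rw [moritaSeq_eq, prod_range_add]
  push_cast
  rw [mul_pow, hsign, one_mul, prod_coprimeFactor_block Q hR]
  refine ((prod_coprimeFactor_blocks hn Q).mul (.refl (rising_mem ?_ R))).pow 4
  exact add_mem (one_mem 𝒪) (mul_mem (natCast_mem 𝒪 p) (natCast_mem 𝒪 Q))

theorem wilson_congrMod : ((p - 1).factorial : ℚ_[p]) ≡[p] -1 := by
  have hzero : (((p - 1).factorial + 1 : ℤ) : ZMod p) = 0 := by
    push_cast
    rw [ZMod.wilsons_lemma, neg_add_cancel]
  obtain ⟨w, hw⟩ := (ZMod.intCast_zmod_eq_zero_iff_dvd _ _).mp hzero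
  have hw' : ((p - 1).factorial : ℚ_[p]) + 1 = p * w := by exact_mod_cast hw
  exact ⟨natCast_mem 𝒪 _, neg_mem (one_mem 𝒪), w, intCast_mem 𝒪 w, by linear_combination hw'⟩

theorem factorial_pred_pow_congrMod {n : ℕ} (hn : p = 2 * n + 1) :
    ((p - 1).factorial : ℚ_[p]) ^ p ≡[(p : ℚ_[p]) ^ 2] -1 := by
  obtain ⟨-, -, w, hw, heq⟩ := wilson_congrMod (p := p)
  have hslope := (HasSlope.one_add (natCast_mem 𝒪 p) (neg_mem hw)).pow p
  have hzero : (p : ℚ_[p]) * -w ≡[p] 0 := by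
    simpa using CongrMod.add_mul_self (zero_mem 𝒪) (natCast_mem 𝒪 p) (neg_mem hw)
  rw [show ((p - 1).factorial : ℚ_[p]) = -(1 + p * -w) by linear_combination heq,
    Odd.neg_pow ⟨n, hn⟩]
  exact (hslope.congrMod_sq_one (natCast_mem 𝒪 p) hzero).neg

theorem padicGamma_quarter_pow_four_congrMod (h3 : 3 < p) {n Q R : ℕ} (hn : p = 2 * n + 1)
    (hR : R < p) (hN : 4 * (p * Q + (R + 1)) = 1 + 3 * p ^ 2) :
    (padicGamma p (padicQuarter p h3) : ℚ_[p]) ^ 4 ≡[(p : ℚ_[p]) ^ 2]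
      ((p - 1).factorial : ℚ_[p]) ^ (4 * Q) * rising (1 + (p : ℚ_[p]) * Q) R ^ 4 := by
  have h := ((padicGamma_quarter_congrMod h3 hN).pow 4).trans (moritaSeq_pow_four_congrMod hn Q hR)
  rwa [mul_pow, ← pow_mul, mul_comm Q] at h

theorem centralRatio_mul_factorial {K : Type*} [Field K] [CharZero K] (m : ℕ) :
    centralRatio K m * (m.factorial ^ 2 * 4 ^ m) = (2 * m).factorial := by
  have h := Nat.choose_mul_factorial_mul_factorial (show m ≤ 2 * m by omega)
  rw [show 2 * m - m = m by omega] at h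
  have h' : (((2 * m).choose m : ℕ) : K) * m.factorial * m.factorial = (2 * m).factorial := by
    exact_mod_cast h
  rw [← h', centralRatio, Nat.centralBinom_eq_two_mul_choose]
  field_simp

theorem hasSlope_two_pow_pred (hp : p ≠ 2) : HasSlope 𝒪 p ((2 : ℚ_[p]) ^ (p - 1)) qₚ := by
  rw [two_pow_pred_eq]
  exact .one_add (natCast_mem 𝒪 p) (fermatQuotient_mem hp)

theorem HasSlope.norm_eq_one {x α : ℚ_[p]} (h : HasSlope 𝒪 p x α) : ‖x‖ = 1 :=
  (h.congrMod_one (natCast_mem 𝒪 p)).norm_eq_one norm_one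

theorem rising_one_add_ne_zero (Q : ℕ) {R : ℕ} (hR : R < p) :
    rising (1 + (p : ℚ_[p]) * Q) R ≠ 0 :=
  (div_ne_zero_iff.mp (ne_zero_of_norm_eq_one (hasSlope_rising_one_add Q hR).norm_eq_one)).1

theorem hasSlope_centralRatio_sq {m : ℕ} (hm : p = 4 * m + 1) :
    HasSlope 𝒪 p
      (centralRatio ℚ_[p] m ^ 2 * (p - 1).factorial ^ 3
        / rising (1 + (p : ℚ_[p]) * (3 * m : ℕ)) (3 * m) ^ 4)
      ((4 : ℕ) * -fieldHarmonic ℚ_[p] 1 m - -fieldHarmonic ℚ_[p] 1 (2 * m) - qₚ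
        - (4 : ℕ) * ((3 * m : ℕ) * fieldHarmonic ℚ_[p] 1 (3 * m))) := by
  have hthree := hasSlope_factorial_pred (p := p) (show 3 * m + m + 1 = p by omega)
  have htwo := hasSlope_factorial_pred (p := p) (show 2 * m + 2 * m + 1 = p by omega)
  have hpow := hasSlope_two_pow_pred (p := p) (by have := (Fact.out : p.Prime).two_le; omega)
  have hrising := hasSlope_rising_one_add (p := p) (3 * m) (show 3 * m < p by omega)
  have h := (((hthree.pow 4).div htwo htwo.norm_eq_one).div hpow hpow.norm_eq_one).div
    (hrising.pow 4) (hrising.pow 4).norm_eq_one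
  have hpow4 : (2 : ℚ_[p]) ^ (p - 1) = (4 ^ m) ^ 2 := by
    rw [show p - 1 = 2 * (m * 2) by omega, pow_mul, pow_mul]
    norm_num
  have hsign : (((-1) ^ m) ^ 4 : ℚ_[p]) = 1 := by
    rw [pow_right_comm, Even.neg_one_pow (by decide), one_pow]
  convert h using 1
  rw [hpow4, ← centralRatio_mul_factorial, pow_mul (-1 : ℚ_[p]) 2 m, neg_one_sq, one_pow]
  have hfact (k : ℕ) : (k.factorial : ℚ_[p]) ≠ 0 := Nat.cast_ne_zero.mpr k.factorial_ne_zero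
  have hcentral0 := centralRatio_ne_zero (K := ℚ_[p]) m
  have hm0 := hfact m
  have h3m0 := hfact (3 * m)
  have hp0 := hfact (p - 1)
  have hrising0 := rising_one_add_ne_zero (p := p) (3 * m) (show 3 * m < p by omega)
  generalize rising (1 + (p : ℚ_[p]) * (3 * m : ℕ)) (3 * m) = r at *
  field_simp
  linear_combination hsign

theorem hasSlope_odd_centralRatio_sq {m : ℕ} (hm : p = 4 * m + 3) :
    HasSlope 𝒪 p
      (-(2 / ((2 * m + 1) * centralRatio ℚ_[p] m)) ^ 2 * (p - 1).factorial ^ 1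
        / rising (1 + (p : ℚ_[p]) * (3 * m + 2 : ℕ)) m ^ 4)
      (-fieldHarmonic ℚ_[p] 1 (2 * m + 1) + qₚ
        - (4 : ℕ) * ((3 * m + 2 : ℕ) * fieldHarmonic ℚ_[p] 1 m)) := by
  have hhalf := hasSlope_factorial_pred (p := p) (show 2 * m + 1 + (2 * m + 1) + 1 = p by omega)
  have hpow := hasSlope_two_pow_pred (p := p) (by omega)
  have hrising := hasSlope_rising_one_add (p := p) (3 * m + 2) (show m < p by omega)
  have h := (hhalf.mul hpow).div (hrising.pow 4) (hrising.pow 4).norm_eq_one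
  have hpow4 : (2 : ℚ_[p]) ^ (p - 1) = 4 * (4 ^ m) ^ 2 := by
    rw [show p - 1 = 2 * (m * 2 + 1) by omega, pow_mul, pow_succ, pow_mul]
    norm_num
    ring
  have hfactorial : ((2 * m + 1).factorial : ℚ_[p])
      = (2 * m + 1) * (centralRatio ℚ_[p] m * (m.factorial ^ 2 * 4 ^ m)) := by
    rw [centralRatio_mul_factorial, Nat.factorial_succ]
    push_cast
    rfl
  convert h using 1
  rw [hpow4, hfactorial, Odd.neg_one_pow ⟨m, rfl⟩]
  have hcentral0 := centralRatio_ne_zero (K := ℚ_[p]) m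
  have hm0 : (m.factorial : ℚ_[p]) ≠ 0 := Nat.cast_ne_zero.mpr m.factorial_ne_zero
  have hodd : (2 * (m : ℚ_[p]) + 1) ≠ 0 := by exact_mod_cast (2 * m).succ_ne_zero
  have hrising0 := rising_one_add_ne_zero (p := p) (3 * m + 2) (show m < p by omega)
  generalize rising (1 + (p : ℚ_[p]) * (3 * m + 2 : ℕ)) m = r at *
  field_simp
  ring

/-- By Wilson's theorem `((p - 1)!) ^ (3 p) ≡ -1` modulo `p²`, and `4 Q + j = 3 p`. -/
theorem neg_congrMod_padicGamma_pow_four (h3 : 3 < p) {n Q R j : ℕ} {x : ℚ_[p]}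
    (hn : p = 2 * n + 1) (hR : R < p) (hN : 4 * (p * Q + (R + 1)) = 1 + 3 * p ^ 2)
    (hj : 4 * Q + j = 3 * p) (hxm : x ∈ 𝒪)
    (hx : x * (p - 1).factorial ^ j / rising (1 + (p : ℚ_[p]) * Q) R ^ 4 ≡[(p : ℚ_[p]) ^ 2] 1) :
    -x ≡[(p : ℚ_[p]) ^ 2] (padicGamma p (padicQuarter p h3) : ℚ_[p]) ^ 4 := by
  set W : ℚ_[p] := ((p - 1).factorial : ℚ_[p])
  set r := rising (1 + (p : ℚ_[p]) * Q) R
  have hr : r ≠ 0 := rising_one_add_ne_zero Q hR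
  have hrm : r ∈ 𝒪 :=
    rising_mem (add_mem (one_mem 𝒪) (mul_mem (natCast_mem 𝒪 p) (natCast_mem 𝒪 Q))) R
  have hWilson : W ^ (4 * Q) * W ^ j ≡[(p : ℚ_[p]) ^ 2] -1 := by
    rw [← pow_add, hj, mul_comm, pow_mul, show (-1 : ℚ_[p]) = (-1) ^ 3 by norm_num]
    exact (factorial_pred_pow_congrMod hn).pow 3
  have hxr : x * W ^ j ≡[(p : ℚ_[p]) ^ 2] r ^ 4 := by
    simpa only [div_mul_cancel₀ _ (pow_ne_zero 4 hr), one_mul] using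
      hx.mul_right (pow_mem hrm 4)
  have hleft := hWilson.symm.mul_left hxm
  have hright := hxr.mul_left (pow_mem (natCast_mem 𝒪 (p - 1).factorial) (4 * Q))
  rw [mul_neg_one, mul_left_comm] at hleft
  exact (hleft.trans hright).trans (padicGamma_quarter_pow_four_congrMod h3 hn hR hN).symm

theorem norm_centralRatio_eq_one {m : ℕ} (h2 : p ≠ 2) (hm : 2 * m < p) :
    ‖centralRatio ℚ_[p] m‖ = 1 := by
  have h := congrArg norm (centralRatio_mul_factorial (K := ℚ_[p]) m)
  rwa [norm_factorial_eq_one hm, norm_mul, norm_mul, norm_pow, norm_pow,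
    norm_factorial_eq_one (by omega), show (4 : ℚ_[p]) = 2 * 2 by norm_num, norm_mul,
    norm_two_eq_one h2, mul_one, one_pow, one_pow, mul_one, mul_one] at h

theorem neg_centralRatio_sq_congrMod_padicGamma (h3 : 3 < p) {m : ℕ} (hm : p = 4 * m + 1) :
    -centralRatio ℚ_[p] m ^ 2 ≡[(p : ℚ_[p]) ^ 2]
      (padicGamma p (padicQuarter p h3) : ℚ_[p]) ^ 4 := by
  have hn : p = 2 * (2 * m) + 1 := by omega
  have hmem : centralRatio ℚ_[p] m ∈ 𝒪 :=
    mem_of_norm_eq_one (norm_centralRatio_eq_one (by omega) (by omega))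
  refine neg_congrMod_padicGamma_pow_four h3 hn (Q := 3 * m) (R := 3 * m) (j := 3) (by omega)
    (by rw [hm]; ring) (by omega) (pow_mem hmem 2)
    ((hasSlope_centralRatio_sq hm).congrMod_sq_one (natCast_mem 𝒪 p) ?_)
  have hpm : (p : ℚ_[p]) = 4 * m + 1 := by exact_mod_cast hm
  have hmul_p := CongrMod.add_mul_self (c := (p : ℚ_[p])) (zero_mem 𝒪) (natCast_mem 𝒪 p)
    (mul_mem (neg_mem (ofNat_mem 𝒪 3)) (fieldHarmonic_mem 1 (show 3 * m < p by omega)))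
  have hreflect := fieldHarmonic_one_reflect hn (show 3 * m + m + 1 = p by omega)
  have hquarter := fieldHarmonic_quarter hn (m := m) (.inl rfl)
  have h := (hmul_p.add (hreflect.mul_left (ofNat_mem 𝒪 3))).sub hquarter
  convert h.sub (.refl h.right_mem) using 1
  · push_cast
    linear_combination 3 * fieldHarmonic ℚ_[p] 1 (3 * m) * hpm
  · ring

theorem odd_centralRatio_sq_congrMod_padicGamma (h3 : 3 < p) {m : ℕ} (hm : p = 4 * m + 3) :
    (2 / ((2 * m + 1) * centralRatio ℚ_[p] m)) ^ 2 ≡[(p : ℚ_[p]) ^ 2]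
      (padicGamma p (padicQuarter p h3) : ℚ_[p]) ^ 4 := by
  have hn : p = 2 * (2 * m + 1) + 1 := by omega
  have hden : ‖(2 * m + 1) * centralRatio ℚ_[p] m‖ = 1 := by
    have hodd := norm_natCast_add_one_eq_one (p := p) (j := 2 * m) (by omega)
    push_cast at hodd
    rw [norm_mul, hodd, norm_centralRatio_eq_one (by omega) (by omega), one_mul]
  have hmem : 2 / ((2 * m + 1) * centralRatio ℚ_[p] m) ∈ 𝒪 :=
    div_mem_of_norm_eq_one (ofNat_mem 𝒪 2) hden
  rw [← neg_neg ((2 / ((2 * m + 1) * centralRatio ℚ_[p] m)) ^ 2)]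
  refine neg_congrMod_padicGamma_pow_four h3 hn (Q := 3 * m + 2) (R := m) (j := 1) (by omega)
    (by rw [hm]; ring) (by omega) (neg_mem (pow_mem hmem 2))
    ((hasSlope_odd_centralRatio_sq hm).congrMod_sq_one (natCast_mem 𝒪 p) ?_)
  have hpm : (p : ℚ_[p]) = 4 * m + 3 := by exact_mod_cast hm
  have hmul_p := CongrMod.add_mul_self (c := (p : ℚ_[p])) (zero_mem 𝒪) (natCast_mem 𝒪 p)
    (mul_mem (neg_mem (ofNat_mem 𝒪 3)) (fieldHarmonic_mem 1 (show m < p by omega)))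
  have h := hmul_p.add (fieldHarmonic_quarter hn (m := m) (.inr rfl))
  convert h.sub (.refl h.right_mem) using 1
  · push_cast
    linear_combination 3 * fieldHarmonic ℚ_[p] 1 m * hpm
  · ring

/-! ## Dixon's sum to first order -/

theorem one_div_add_congrMod {x y : ℚ_[p]} (hx : ‖x‖ = 1) (hy : y ∈ 𝒪) :
    1 / (x + p * y) ≡[(p : ℚ_[p]) ^ 2] 1 / x - p * (y * (1 / x ^ 2)) := by
  have hp := natCast_mem 𝒪 p
  have hxy : ‖x + p * y‖ = 1 :=
    (CongrMod.add_mul_self (mem_of_norm_eq_one hx) hp hy).norm_eq_one hx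
  have hx0 := ne_zero_of_norm_eq_one hx
  have hxy0 := ne_zero_of_norm_eq_one hxy
  have hx' : 1 / x ∈ 𝒪 := div_mem_of_norm_eq_one (one_mem 𝒪) hx
  have hsq : 1 / x ^ 2 ∈ 𝒪 := by rw [← one_div_pow]; exact pow_mem hx' 2
  have hxy' : 1 / (x + p * y) ∈ 𝒪 := div_mem_of_norm_eq_one (one_mem 𝒪) hxy
  refine ⟨hxy', sub_mem hx' (mul_mem hp (mul_mem hy hsq)), y ^ 2 * (1 / x ^ 2) * (1 / (x + p * y)),
    mul_mem (mul_mem (pow_mem hy 2) hsq) hxy', ?_⟩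
  field_simp
  ring

theorem sum_one_div_add_congrMod {f : ℕ → ℚ_[p]} {y : ℚ_[p]} (hy : y ∈ 𝒪) {k : ℕ}
    (hf : ∀ j < k, ‖f j‖ = 1) :
    ∑ j ∈ range k, 1 / (f j + p * y) ≡[(p : ℚ_[p]) ^ 2]
      ∑ j ∈ range k, 1 / f j - p * (y * ∑ j ∈ range k, 1 / f j ^ 2) := by
  rw [mul_sum, mul_sum, ← sum_sub_distrib]
  exact .sum fun j hj => one_div_add_congrMod (hf j (mem_range.mp hj)) hy

theorem dixonTerm_half {K : Type*} [Field K] [CharZero K] (n k : ℕ) :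
    dixonTerm (1 / 2 : K) (n + 1) n k
      = rising (-(n : K)) k * rising ((n : K) + 1) k * rising (1 / 2) k / k.factorial /
        (rising (1 / 2 - (n : K)) k * rising ((n : K) + 3 / 2) k) := by
  rw [dixonTerm, show 1 + 1 / 2 - ((n : K) + 1) = 1 / 2 - n by ring,
    show 1 + 1 / 2 + (n : K) = n + 3 / 2 by ring, div_div, mul_assoc (k.factorial : K)]
  ring

theorem dixonTerm_shift {K : Type*} [Field K] {a b x : K} {n k : ℕ} (ha : rising a k ≠ 0)
    (hb : rising b k ≠ 0) (hab : rising (1 + a - b) k ≠ 0) (han : rising (1 + a + n) k ≠ 0) :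
    dixonTerm (a + x) (b - x) n k = dixonTerm a b n k *
      (rising (a + x) k / rising a k * (rising (b - x) k / rising b k) /
        (rising (1 + a - b + x * 2) k / rising (1 + a - b) k *
          (rising (1 + a + n + x) k / rising (1 + a + n) k))) := by
  rw [dixonTerm, dixonTerm, show 1 + (a + x) - (b - x) = 1 + a - b + x * 2 by ring,
    show 1 + (a + x) + n = 1 + a + n + x by ring]
  field_simp

/-- The logarithmic derivative at `x = 0` of `dixonTerm (1/2 + x) (n + 1 - x) n k`. -/
def dixonSlope (K : Type*) [Field K] (n k : ℕ) : K :=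
  ∑ j ∈ range k, 1 / (1 / 2 + (j : K)) - ∑ j ∈ range k, 1 / ((n : K) + 1 + j)
    - (2 * ∑ j ∈ range k, 1 / (1 / 2 - (n : K) + j) + ∑ j ∈ range k, 1 / ((n : K) + 3 / 2 + j))

/-- The quadratic odd harmonic sum `∑_{j<k} (1/2 + j)⁻²`. -/
def oddHarmonic (K : Type*) [Field K] (k : ℕ) : K := ∑ j ∈ range k, 1 / (1 / 2 + (j : K)) ^ 2

section PrimeEqTwoMulAddOne

variable {n : ℕ} (hn : p = 2 * n + 1)

include hn in
theorem norm_half_add_eq_one {j : ℕ} (hj : j < n) : ‖(1 / 2 : ℚ_[p]) + j‖ = 1 := by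
  have h := norm_natCast_eq_one (p := p) (j := 2 * j + 1) (by omega) (by omega)
  rw [show (1 / 2 : ℚ_[p]) + j = ((2 * j + 1 : ℕ) : ℚ_[p]) / 2 by push_cast; ring, norm_div, h,
    norm_two_eq_one (by omega), div_one]

include hn in
theorem norm_add_one_add_eq_one {j : ℕ} (hj : j < n) : ‖(n : ℚ_[p]) + 1 + j‖ = 1 := by
  exact_mod_cast norm_natCast_eq_one (p := p) (j := n + 1 + j) (by omega) (by omega)

include hn in
theorem half_sub_add_eq (j : ℕ) : (1 / 2 : ℚ_[p]) - n + j = j + 1 + p * -(1 / 2) := by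
  rw [show (p : ℚ_[p]) = 2 * n + 1 by exact_mod_cast congrArg (Nat.cast : ℕ → ℚ_[p]) hn]
  ring

include hn in
theorem add_three_halves_add_eq (j : ℕ) : (n : ℚ_[p]) + 3 / 2 + j = j + 1 + p * (1 / 2) := by
  rw [show (p : ℚ_[p]) = 2 * n + 1 by exact_mod_cast congrArg (Nat.cast : ℕ → ℚ_[p]) hn]
  ring

include hn in
theorem add_one_add_eq (j : ℕ) : (n : ℚ_[p]) + 1 + j = 1 / 2 + j + p * (1 / 2) := by
  rw [show (p : ℚ_[p]) = 2 * n + 1 by exact_mod_cast congrArg (Nat.cast : ℕ → ℚ_[p]) hn]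
  ring

include hn in
theorem norm_half_sub_add_eq_one {j : ℕ} (hj : j < n) : ‖(1 / 2 : ℚ_[p]) - n + j‖ = 1 := by
  have hj1 := norm_natCast_add_one_eq_one (p := p) (show j + 1 < p by omega)
  rw [half_sub_add_eq hn]
  exact (CongrMod.add_mul_self (mem_of_norm_eq_one hj1) (natCast_mem 𝒪 p)
    (neg_mem (one_half_mem (by omega)))).norm_eq_one hj1

include hn in
theorem norm_add_three_halves_add_eq_one {j : ℕ} (hj : j < n) :
    ‖(n : ℚ_[p]) + 3 / 2 + j‖ = 1 := by
  have hj1 := norm_natCast_add_one_eq_one (p := p) (show j + 1 < p by omega)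
  rw [add_three_halves_add_eq hn]
  exact (CongrMod.add_mul_self (mem_of_norm_eq_one hj1) (natCast_mem 𝒪 p)
    (one_half_mem (by omega))).norm_eq_one hj1

include hn in
/-- Since `p = 2 n + 1`, the factors satisfy `(1/2 - n + j)(n + 3/2 + j) = (j + 1)² - p² / 4`. -/
theorem rising_half_sub_mul_rising_congrMod (k : ℕ) :
    rising (1 / 2 - (n : ℚ_[p])) k * rising ((n : ℚ_[p]) + 3 / 2) k ≡[(p : ℚ_[p]) ^ 2]
      (k.factorial : ℚ_[p]) ^ 2 := by
  have hhalf := one_half_mem (p := p) (by omega)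
  have hp := natCast_mem 𝒪 p
  rw [← rising_one, sq (rising 1 k)]
  simp only [rising_eq_prod, ← prod_mul_distrib]
  refine .prod fun j _ => ?_
  have hj : (1 : ℚ_[p]) + j ∈ 𝒪 := add_mem (one_mem 𝒪) (natCast_mem 𝒪 j)
  rw [half_sub_add_eq hn, add_three_halves_add_eq hn, add_comm (j : ℚ_[p])]
  exact ⟨mul_mem (add_mem hj (mul_mem hp (neg_mem hhalf))) (add_mem hj (mul_mem hp hhalf)),
    mul_mem hj hj, -(1 / 2 * (1 / 2)), neg_mem (mul_mem hhalf hhalf), by ring⟩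

include hn in
theorem dixonTerm_half_congrMod {k : ℕ} (hk : k ≤ n) :
    dixonTerm (1 / 2 : ℚ_[p]) (n + 1) n k ≡[(p : ℚ_[p]) ^ 2] legendreTerm ℚ_[p] n k := by
  have hfact := norm_factorial_eq_one (show k < p by omega)
  have hnum : rising (-(n : ℚ_[p])) k * rising ((n : ℚ_[p]) + 1) k * rising (1 / 2) k /
      k.factorial ∈ 𝒪 :=
    div_mem_of_norm_eq_one (mul_mem (mul_mem (rising_mem (neg_mem (natCast_mem 𝒪 n)) k)
      (rising_mem (add_mem (natCast_mem 𝒪 n) (one_mem 𝒪)) k))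
      (rising_mem (one_half_mem (by omega)) k)) hfact
  have hden : ‖rising (1 / 2 - (n : ℚ_[p])) k * rising ((n : ℚ_[p]) + 3 / 2) k‖ = 1 := by
    rw [norm_mul, norm_rising_eq_one fun j hj => norm_half_sub_add_eq_one hn (by omega),
      norm_rising_eq_one fun j hj => norm_add_three_halves_add_eq_one hn (by omega), one_mul]
  have h := (CongrMod.refl hnum).div (rising_half_sub_mul_rising_congrMod hn k) hden
    (by rw [norm_pow, hfact, one_pow])
  rwa [← dixonTerm_half, div_div _ (k.factorial : ℚ_[p]), ← pow_succ'] at h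

include hn in
theorem dixonTerm_shift_congrMod {k : ℕ} (hk : k ≤ n) :
    dixonTerm (1 / 2 + (p : ℚ_[p]) ^ 2) (n + 1 - (p : ℚ_[p]) ^ 2) n k ≡[((p : ℚ_[p]) ^ 2) ^ 2]
      dixonTerm (1 / 2 : ℚ_[p]) (n + 1) n k * (1 + (p : ℚ_[p]) ^ 2 * dixonSlope ℚ_[p] n k) := by
  have hc : (p : ℚ_[p]) ^ 2 ∈ 𝒪 := pow_mem (natCast_mem 𝒪 p) 2
  have hnorm {x α : ℚ_[p]} (h : HasSlope 𝒪 ((p : ℚ_[p]) ^ 2) x α) : ‖x‖ = 1 :=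
    (h.congrMod_one hc).of_sq.norm_eq_one norm_one
  have ha : ∀ j < k, ‖(1 / 2 : ℚ_[p]) + j‖ = 1 := fun j hj => norm_half_add_eq_one hn (by omega)
  have hb : ∀ j < k, ‖(n : ℚ_[p]) + 1 + j‖ = 1 := fun j hj => norm_add_one_add_eq_one hn (by omega)
  have hab : ∀ j < k, ‖(1 / 2 : ℚ_[p]) - n + j‖ = 1 :=
    fun j hj => norm_half_sub_add_eq_one hn (by omega)
  have han : ∀ j < k, ‖(n : ℚ_[p]) + 3 / 2 + j‖ = 1 :=
    fun j hj => norm_add_three_halves_add_eq_one hn (by omega)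
  have hslope_a := hasSlope_rising_div_rising hc (one_mem 𝒪) ha
  have hslope_b := hasSlope_rising_div_rising hc (neg_mem (one_mem 𝒪)) hb
  have hslope_ab := hasSlope_rising_div_rising hc (ofNat_mem 𝒪 2) hab
  have hslope_an := hasSlope_rising_div_rising hc (one_mem 𝒪) han
  have hslope_den := hslope_ab.mul hslope_an
  have hslope := (hslope_a.mul hslope_b).div hslope_den (hnorm hslope_den)
  have hab_eq : (1 : ℚ_[p]) + 1 / 2 - (n + 1) = 1 / 2 - n := by ring
  have han_eq : (1 : ℚ_[p]) + 1 / 2 + n = n + 3 / 2 := by ring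
  have hshift := dixonTerm_shift (x := (p : ℚ_[p]) ^ 2) (n := n)
    (ne_zero_of_norm_eq_one (norm_rising_eq_one ha))
    (ne_zero_of_norm_eq_one (norm_rising_eq_one hb))
    (by rw [hab_eq]; exact ne_zero_of_norm_eq_one (norm_rising_eq_one hab))
    (by rw [han_eq]; exact ne_zero_of_norm_eq_one (norm_rising_eq_one han))
  rw [hab_eq, han_eq] at hshift
  rw [hshift, dixonSlope]
  simpa only [mul_one, one_mul, mul_neg, neg_mul, ← sub_eq_add_neg]
    using hslope.2.mul_left (dixonTerm_half_congrMod hn hk).left_mem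

include hn in
theorem dixonSlope_congrMod {k : ℕ} (hk : k ≤ n) :
    dixonSlope ℚ_[p] n k ≡[(p : ℚ_[p]) ^ 2]
      -3 * fieldHarmonic ℚ_[p] 1 k
        + p * (1 / 2 * (oddHarmonic ℚ_[p] k - fieldHarmonic ℚ_[p] 2 k)) := by
  have hhalf := one_half_mem (p := p) (by omega)
  have ha : ∀ j < k, ‖(1 / 2 : ℚ_[p]) + j‖ = 1 := fun j hj => norm_half_add_eq_one hn (by omega)
  have hj1 : ∀ j < k, ‖(j : ℚ_[p]) + 1‖ = 1 :=
    fun j hj => norm_natCast_add_one_eq_one (by omega)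
  have ha_mem : ∑ j ∈ range k, 1 / (1 / 2 + (j : ℚ_[p])) ∈ 𝒪 :=
    sum_mem fun j hj => div_mem_of_norm_eq_one (one_mem 𝒪) (ha j (mem_range.mp hj))
  have hb := sum_one_div_add_congrMod hhalf ha
  have hab := sum_one_div_add_congrMod (neg_mem hhalf) hj1
  have han := sum_one_div_add_congrMod hhalf hj1
  simp only [← add_one_add_eq hn] at hb
  simp only [← half_sub_add_eq hn] at hab
  simp only [← add_three_halves_add_eq hn] at han
  have h := ((CongrMod.refl ha_mem).sub hb).sub ((hab.mul_left (ofNat_mem 𝒪 2)).add han)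
  rw [dixonSlope]
  convert h using 1
  simp only [fieldHarmonic, oddHarmonic, pow_one]
  ring

include hn in
theorem dixonTerm_shift_sub_congrMod {k : ℕ} (hk : k ≤ n) :
    dixonTerm (1 / 2 + (p : ℚ_[p]) ^ 2) (n + 1 - (p : ℚ_[p]) ^ 2) n k
        - dixonTerm (1 / 2 : ℚ_[p]) (n + 1) n k ≡[((p : ℚ_[p]) ^ 2) ^ 2]
      (p : ℚ_[p]) ^ 2 * (legendreTerm ℚ_[p] n k * (-3 * fieldHarmonic ℚ_[p] 1 k
        + p * (1 / 2 * (oddHarmonic ℚ_[p] k - fieldHarmonic ℚ_[p] 2 k)))) := by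
  have hterm := dixonTerm_half_congrMod hn hk
  have hdiff := (dixonTerm_shift_congrMod hn hk).sub (.refl hterm.left_mem)
  rw [show ∀ t c σ : ℚ_[p], t * (1 + c * σ) - t = c * (t * σ) by intros; ring] at hdiff
  exact hdiff.trans
    ((hterm.mul (dixonSlope_congrMod hn hk)).scale_self (pow_mem (natCast_mem 𝒪 p) 2))

end PrimeEqTwoMulAddOne

theorem alternating_choose_cube_sum_eq_zero {K : Type*} [Field K] [CharZero K] {n : ℕ}
    (hn : Odd n) {c : ℕ → K} (hc : ∀ k ≤ n, c (n - k) = c k) :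
    ∑ k ∈ range (n + 1), ((-1) ^ k * (n.choose k : K)) ^ 3 * c k = 0 := by
  rw [← CharZero.eq_neg_self_iff, ← sum_neg_distrib, ← sum_range_reflect]
  refine sum_congr rfl fun k hk => ?_
  have hkn : k ≤ n := mem_range_succ_iff.mp hk
  have hsign : (-1 : K) ^ (n - k) = -(-1) ^ k := by
    have h := hn.neg_one_pow (α := K)
    rw [← Nat.sub_add_cancel hkn, pow_add] at h
    linear_combination (-1) ^ k * h - (-1) ^ (n - k) * (even_two_mul k).neg_one_pow (α := K)
  rw [add_tsub_cancel_right, hc k hkn, Nat.choose_symm hkn, hsign]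
  ring

section OddHalf

variable {n : ℕ} (hn : p = 2 * n + 1)

include hn in
theorem oddHarmonic_congrMod {k : ℕ} (hk : k ≤ n) :
    oddHarmonic ℚ_[p] k ≡[p] fieldHarmonic ℚ_[p] 2 n - fieldHarmonic ℚ_[p] 2 (n - k) := by
  have hsplit := sum_range_add_reflect (fun j => 1 / ((j : ℚ_[p]) + 1) ^ 2) (n - k) k
  rw [Nat.sub_add_cancel hk] at hsplit
  rw [fieldHarmonic, fieldHarmonic, hsplit, add_sub_cancel_left, oddHarmonic]
  refine .sum fun i hi => ?_
  have hik : i < k := mem_range.mp hi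
  have hsum := half_sub_add_eq hn (n - k + (k - 1 - i))
  have hodd := norm_half_add_eq_one hn (show i < n by omega)
  have hnat := norm_natCast_add_one_eq_one (p := p) (j := n - k + (k - 1 - i)) (by omega)
  have hcast : ((n - k + (k - 1 - i) : ℕ) : ℚ_[p]) = n - 1 - i := by
    rw [show n - k + (k - 1 - i) = n - (i + 1) by omega, Nat.cast_sub (by omega)]
    push_cast
    ring
  rw [hcast] at hnat hsum ⊢
  have hneg : -(1 / 2 + (i : ℚ_[p])) ≡[p] n - 1 - i + 1 := by
    rw [show -(1 / 2 + (i : ℚ_[p])) = n - 1 - i + 1 + p * -(1 / 2) by rw [← hsum]; ring]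
    exact .add_mul_self (mem_of_norm_eq_one hnat) (natCast_mem 𝒪 p)
      (neg_mem (one_half_mem (by omega)))
  have h := (hneg.inv (by rwa [norm_neg]) hnat).pow 2
  simpa only [one_div, inv_pow, neg_sq] using h

include hn in
theorem legendreTerm_congrMod_choose {k : ℕ} (hk : k ≤ n) :
    legendreTerm ℚ_[p] n k ≡[p] ((-1) ^ k * (n.choose k : ℚ_[p])) ^ 3 := by
  have hpn : (p : ℚ_[p]) = 2 * n + 1 := by exact_mod_cast congrArg (Nat.cast : ℕ → ℚ_[p]) hn
  have hneg : -(n : ℚ_[p]) ∈ 𝒪 := neg_mem (natCast_mem 𝒪 n)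
  have hfact := norm_factorial_eq_one (show k < p by omega)
  have hsucc : (n : ℚ_[p]) + 1 ≡[p] -n :=
    ⟨add_mem (natCast_mem 𝒪 n) (one_mem 𝒪), hneg, 1, one_mem 𝒪, by rw [hpn]; ring⟩
  have hhalf : (1 / 2 : ℚ_[p]) ≡[p] -n :=
    ⟨one_half_mem (by omega), hneg, 1 / 2, one_half_mem (by omega), by rw [hpn]; ring⟩
  have h := (((hsucc.rising k).mul_left (rising_mem hneg k)).mul (hhalf.rising k)).mul_right
    (inv_mem_of_norm_eq_one (x := (k.factorial : ℚ_[p]) ^ 3) (by rw [norm_pow, hfact, one_pow]))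
  have hfact0 := ne_zero_of_norm_eq_one hfact
  rw [legendreTerm, hyperTerm, div_eq_mul_inv]
  convert h using 1
  rw [rising_neg_natCast]
  field_simp

include hn in
theorem legendreSum_oddHarmonic_sub_congrMod (hodd : Odd n) :
    legendreSum ℚ_[p] (fun k => oddHarmonic ℚ_[p] k - fieldHarmonic ℚ_[p] 2 k) n ≡[p] 0 := by
  rw [← alternating_choose_cube_sum_eq_zero (K := ℚ_[p]) hodd (c := fun k =>
    fieldHarmonic ℚ_[p] 2 n - fieldHarmonic ℚ_[p] 2 (n - k) - fieldHarmonic ℚ_[p] 2 k)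
    fun k hk => by rw [Nat.sub_sub_self hk]; ring]
  refine .sum fun k hk => ?_
  have hkn : k ≤ n := mem_range_succ_iff.mp hk
  exact (legendreTerm_congrMod_choose hn hkn).mul
    ((oddHarmonic_congrMod hn hkn).sub (.refl (fieldHarmonic_mem 2 (by omega))))

include hn in
theorem dixon_sum_sub_congrMod (hodd : Odd n) :
    ∑ k ∈ range (n + 1), dixonTerm (1 / 2 + (p : ℚ_[p]) ^ 2) (n + 1 - (p : ℚ_[p]) ^ 2) n k
        - ∑ k ∈ range (n + 1), dixonTerm (1 / 2 : ℚ_[p]) (n + 1) n k ≡[((p : ℚ_[p]) ^ 2) ^ 2]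
      (p : ℚ_[p]) ^ 2 * (-3 * legendreSum ℚ_[p] (fieldHarmonic ℚ_[p] 1) n) := by
  have hp := natCast_mem 𝒪 p
  have hsplit : ∑ k ∈ range (n + 1), legendreTerm ℚ_[p] n k * (-3 * fieldHarmonic ℚ_[p] 1 k
        + p * (1 / 2 * (oddHarmonic ℚ_[p] k - fieldHarmonic ℚ_[p] 2 k)))
      = -3 * legendreSum ℚ_[p] (fieldHarmonic ℚ_[p] 1) n + p * (1 / 2 *
        legendreSum ℚ_[p] (fun k => oddHarmonic ℚ_[p] k - fieldHarmonic ℚ_[p] 2 k) n) := by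
    simp only [legendreSum, mul_sum, ← sum_add_distrib]
    exact sum_congr rfl fun k _ => by ring
  have hterms := CongrMod.sum fun k hk =>
    dixonTerm_shift_sub_congrMod hn (mem_range_succ_iff.mp hk)
  rw [sum_sub_distrib, ← mul_sum, hsplit] at hterms
  have hmem : legendreSum ℚ_[p] (fieldHarmonic ℚ_[p] 1) n ∈ 𝒪 := sum_mem fun k hk =>
    mul_mem (legendreTerm_congrMod_choose hn (mem_range_succ_iff.mp hk)).left_mem
      (fieldHarmonic_mem 1 (by rw [mem_range] at hk; omega))
  have hvanish := ((legendreSum_oddHarmonic_sub_congrMod hn hodd).mul_left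
    (one_half_mem (by omega))).scale_self hp
  rw [mul_zero, mul_zero] at hvanish
  have hmain := (CongrMod.refl (mul_mem (neg_mem (ofNat_mem 𝒪 3)) hmem)).add hvanish
  rw [add_zero] at hmain
  exact hterms.trans (hmain.scale_self (pow_mem hp 2))

end OddHalf

theorem one_quarter_mem (hp : p ≠ 2) : (1 / 4 : ℚ_[p]) ∈ 𝒪 := by
  rw [show (1 / 4 : ℚ_[p]) = 1 / 2 * (1 / 2) by norm_num]
  exact mul_mem (one_half_mem hp) (one_half_mem hp)

theorem one_eighth_mem (hp : p ≠ 2) : (1 / 8 : ℚ_[p]) ∈ 𝒪 := by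
  rw [show (1 / 8 : ℚ_[p]) = 1 / 2 * (1 / 4) by norm_num]
  exact mul_mem (one_half_mem hp) (one_quarter_mem hp)

theorem factorial_mul_factorial_congrMod {m k : ℕ} (hmk : m + k + 1 = p) :
    (-1) ^ k * (m.factorial : ℚ_[p]) * k.factorial ≡[p] -1 := by
  have hden : (-1) ^ k * (m.factorial : ℚ_[p]) * k.factorial ∈ 𝒪 :=
    mul_mem (mul_mem (pow_mem (neg_mem (one_mem 𝒪)) k) (natCast_mem 𝒪 _)) (natCast_mem 𝒪 _)
  have hden0 : (-1) ^ k * (m.factorial : ℚ_[p]) * k.factorial ≠ 0 := by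
    simp [Nat.factorial_ne_zero]
  have h := ((hasSlope_factorial_pred hmk).congrMod_one (natCast_mem 𝒪 p)).mul_right hden
  rw [div_mul_cancel₀ _ hden0, one_mul] at h
  exact h.symm.trans wilson_congrMod

/-- The numerator of Dixon's product for `a = 1/2 + X`, `b = n + 1 - X` with `n = 2 m + 1`, without
the two factors that are divisible by `p = 4 m + 3` at `X = 0`. -/
noncomputable def dixonNumerator (K : Type*) [Field K] (m : ℕ) (X : K) : K :=
  rising (3 / 2 + X) (2 * m) *
    (rising (1 / 4 - (2 * m + 1) + 3 / 2 * X) m * rising (1 / 4 - m + 3 / 2 * X) m)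

/-- The denominator of Dixon's product for `a = 1/2 + X`, `b = n + 1 - X` with `n = 2 m + 1`. -/
noncomputable def dixonDenominator (K : Type*) [Field K] (m : ℕ) (X : K) : K :=
  rising (5 / 4 + 1 / 2 * X) (2 * m + 1) * rising (1 / 2 - (2 * m + 1) + 2 * X) (2 * m + 1)

theorem dixon_sum_half_add {K : Type*} [Field K] [CharZero K] (m x : ℕ) :
    ∑ k ∈ range (2 * m + 1 + 1),
        dixonTerm (1 / 2 + (x : K)) ((2 * m + 1 : ℕ) + 1 - x) (2 * m + 1) k
      = ((4 * m + 3) / 2 + x) * (-((4 * m + 3) / 4) + 3 / 2 * x) *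
        (dixonNumerator K m x / dixonDenominator K m x) := by
  rw [dixon_sum]
  · have hfirst : rising (1 + (1 / 2 + (x : K))) (2 * m + 1)
        = rising (3 / 2 + (x : K)) (2 * m) * ((4 * m + 3) / 2 + x) := by
      rw [rising_succ, show (1 : K) + (1 / 2 + x) = 3 / 2 + x by ring]
      push_cast
      ring
    have hsecond : rising (1 + (1 / 2 + (x : K)) / 2 - ((2 * m + 1 : ℕ) + 1 - x)) (2 * m + 1)
        = rising (1 / 4 - (2 * m + 1) + 3 / 2 * (x : K)) m * (-((4 * m + 3) / 4) + 3 / 2 * x) *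
          rising (1 / 4 - m + 3 / 2 * (x : K)) m := by
      rw [show 1 + (1 / 2 + (x : K)) / 2 - ((2 * m + 1 : ℕ) + 1 - x)
          = 1 / 4 - (2 * m + 1) + 3 / 2 * x by push_cast; ring,
        show 2 * m + 1 = m + 1 + m by ring, rising_add, rising_succ]
      congr 2
      all_goals push_cast; ring
    rw [hfirst, hsecond, dixonNumerator, dixonDenominator,
      show 1 + (1 / 2 + (x : K)) / 2 = 5 / 4 + 1 / 2 * x by ring,
      show 1 + (1 / 2 + (x : K)) - ((2 * m + 1 : ℕ) + 1 - x) = 1 / 2 - (2 * m + 1) + 2 * x by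
        push_cast; ring]
    ring
  · intro j
    have h : ((3 + 2 * x + 2 * j : ℕ) : K) ≠ 0 := Nat.cast_ne_zero.mpr (by omega)
    contrapose! h
    push_cast
    linear_combination 2 * h
  · intro j
    have h : ((1 + 4 * x + 2 * j : ℕ) : K) ≠ (4 * m + 2 : ℕ) := Nat.cast_injective.ne (by omega)
    contrapose! h
    push_cast at h ⊢
    linear_combination 2 * h
  · intro j
    have h : ((5 + 2 * x + 4 * j : ℕ) : K) ≠ 0 := Nat.cast_ne_zero.mpr (by omega)
    contrapose! h
    push_cast
    linear_combination 4 * h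

theorem rising_add_mul_congrMod {a b X Y c : ℚ_[p]} (ha : a ∈ 𝒪) (hb : b ∈ 𝒪) (hXY : X ≡[c] Y)
    (k : ℕ) : rising (a + b * X) k ≡[c] rising (a + b * Y) k :=
  ((CongrMod.refl ha).add (hXY.mul_left hb)).rising k

section PrimeEqFourMulAddThree

variable {m : ℕ} (hm : p = 4 * m + 3)

include hm in
theorem dixonNumerator_congrMod {c X Y : ℚ_[p]} (hXY : X ≡[c] Y) :
    dixonNumerator ℚ_[p] m X ≡[c] dixonNumerator ℚ_[p] m Y := by
  have hquarter := one_quarter_mem (p := p) (by omega)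
  have hm' := natCast_mem 𝒪 m
  have hthree : (3 / 2 : ℚ_[p]) ∈ 𝒪 :=
    div_mem_of_norm_eq_one (ofNat_mem 𝒪 3) (norm_two_eq_one (by omega))
  exact (((CongrMod.refl hthree).add hXY).rising _).mul
    ((rising_add_mul_congrMod (sub_mem hquarter
      (add_mem (mul_mem (ofNat_mem 𝒪 2) hm') (one_mem 𝒪))) hthree hXY _).mul
    (rising_add_mul_congrMod (sub_mem hquarter hm') hthree hXY _))

include hm in
theorem dixonDenominator_congrMod {c X Y : ℚ_[p]} (hXY : X ≡[c] Y) :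
    dixonDenominator ℚ_[p] m X ≡[c] dixonDenominator ℚ_[p] m Y := by
  have hhalf := one_half_mem (p := p) (by omega)
  have hfive : (5 / 4 : ℚ_[p]) ∈ 𝒪 := by
    rw [show (5 / 4 : ℚ_[p]) = 1 + 1 / 4 by norm_num]
    exact add_mem (one_mem 𝒪) (one_quarter_mem (by omega))
  exact (rising_add_mul_congrMod hfive hhalf hXY _).mul (rising_add_mul_congrMod (sub_mem hhalf
    (add_mem (mul_mem (ofNat_mem 𝒪 2) (natCast_mem 𝒪 m)) (one_mem 𝒪))) (ofNat_mem 𝒪 2) hXY _)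

include hm in
theorem dixonNumerator_zero_congrMod :
    dixonNumerator ℚ_[p] m 0 ≡[p]
      (2 * m).factorial * ((-1) ^ m * m.factorial * m.factorial) := by
  have hpm : (p : ℚ_[p]) = 4 * m + 3 := by exact_mod_cast hm
  have hp := natCast_mem 𝒪 p
  have hquarter := one_quarter_mem (p := p) (by omega)
  have hfirst := (CongrMod.add_mul_self (neg_mem (natCast_mem 𝒪 (2 * m))) hp
    (one_half_mem (by omega))).rising (2 * m)
  have hsecond := (CongrMod.add_mul_self (neg_mem (natCast_mem 𝒪 m)) hp
    (neg_mem hquarter)).rising m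
  have hthird := (CongrMod.add_mul_self (one_mem 𝒪) hp (neg_mem hquarter)).rising m
  have hfirst_eq : (3 / 2 + 0 : ℚ_[p]) = -(2 * m : ℕ) + p * (1 / 2) := by
    rw [hpm]
    push_cast
    ring
  have hsecond_eq : (1 / 4 - (2 * m + 1) + 3 / 2 * 0 : ℚ_[p]) = -m + p * -(1 / 4) := by
    rw [hpm]
    ring
  have hthird_eq : (1 / 4 - m + 3 / 2 * 0 : ℚ_[p]) = 1 + p * -(1 / 4) := by
    rw [hpm]
    ring
  have h := hfirst.mul (hsecond.mul hthird)
  rw [rising_neg_natCast, rising_neg_natCast, rising_one, Nat.choose_self, Nat.choose_self,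
    Nat.cast_one, one_mul, one_mul, (even_two_mul m).neg_one_pow, one_mul] at h
  rwa [dixonNumerator, hfirst_eq, hsecond_eq, hthird_eq]

include hm in
theorem dixonDenominator_zero_congrMod :
    dixonDenominator ℚ_[p] m 0 ≡[p]
      rising (((m + 1 : ℕ) : ℚ_[p]) + 1) (2 * m + 1) * (2 * m + 1).factorial := by
  have hpm : (p : ℚ_[p]) = 4 * m + 3 := by exact_mod_cast hm
  have hp := natCast_mem 𝒪 p
  have hfirst := (CongrMod.add_mul_self (add_mem (natCast_mem 𝒪 (m + 1)) (one_mem 𝒪)) hp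
    (neg_mem (one_quarter_mem (by omega)))).rising (2 * m + 1)
  have hsecond := (CongrMod.add_mul_self (one_mem 𝒪) hp
    (neg_mem (one_half_mem (by omega)))).rising (2 * m + 1)
  have hfirst_eq : (5 / 4 + 1 / 2 * 0 : ℚ_[p]) = (m + 1 : ℕ) + 1 + p * -(1 / 4) := by
    rw [hpm]
    push_cast
    ring
  have hsecond_eq : (1 / 2 - (2 * m + 1) + 2 * 0 : ℚ_[p]) = 1 + p * -(1 / 2) := by
    rw [hpm]
    ring
  have h := hfirst.mul hsecond
  rw [rising_one] at h
  rwa [dixonDenominator, hfirst_eq, hsecond_eq]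

include hm in
theorem norm_rising_mul_factorial_eq_one :
    ‖rising (((m + 1 : ℕ) : ℚ_[p]) + 1) (2 * m + 1) * (2 * m + 1).factorial‖ = 1 := by
  have h := congrArg norm (factorial_mul_rising_natCast_add_one (R := ℚ_[p]) (m + 1) (2 * m + 1))
  rw [norm_mul, norm_factorial_eq_one (by omega), norm_factorial_eq_one (by omega), one_mul] at h
  rw [norm_mul, h, norm_factorial_eq_one (by omega), one_mul]

include hm in
theorem norm_dixonDenominator_eq_one {X : ℚ_[p]} (hX : X ≡[p] 0) :
    ‖dixonDenominator ℚ_[p] m X‖ = 1 :=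
  ((dixonDenominator_congrMod hm hX).trans (dixonDenominator_zero_congrMod hm)).norm_eq_one
    (norm_rising_mul_factorial_eq_one hm)

include hm in
theorem two_mul_factorial_congrMod :
    2 * ((2 * m).factorial * ((-1) ^ m * (m.factorial : ℚ_[p]) * m.factorial)) ≡[p]
      m.factorial ^ 4 *
        (rising (((m + 1 : ℕ) : ℚ_[p]) + 1) (2 * m + 1) * (2 * m + 1).factorial) := by
  have hpm : (p : ℚ_[p]) = 4 * m + 3 := by exact_mod_cast hm
  have hcofactor : (2 * m).factorial * ((-1) ^ m * (m.factorial : ℚ_[p]) ^ 3) ∈ 𝒪 :=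
    mul_mem (natCast_mem 𝒪 _)
      (mul_mem (pow_mem (neg_mem (one_mem 𝒪)) m) (pow_mem (natCast_mem 𝒪 _) 3))
  have hwilson := (factorial_mul_factorial_congrMod (show 3 * m + 2 + m + 1 = p by omega)).mul_left
    (mul_mem (natCast_mem 𝒪 (2 * m + 1)) hcofactor)
  have hneg := (CongrMod.add_mul_self (neg_mem (natCast_mem 𝒪 (2 * m + 1)))
    (natCast_mem 𝒪 p) (one_mem 𝒪)).mul_right hcofactor
  refine .of_mul_left (norm_factorial_eq_one (k := m + 1) (by omega)) ?_
  have hrising := factorial_mul_rising_natCast_add_one (R := ℚ_[p]) (m + 1) (2 * m + 1)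
  have hsign : ((-1) ^ m * (-1) ^ m : ℚ_[p]) = 1 := by rw [← mul_pow, neg_mul_neg, one_mul, one_pow]
  rw [show m + 1 + (2 * m + 1) = 3 * m + 2 by ring] at hrising
  rw [mul_neg_one, ← neg_mul] at hwilson
  convert hneg.trans hwilson.symm using 1
  · rw [hpm, Nat.factorial_succ]
    push_cast
    ring
  · rw [mul_left_comm, ← mul_assoc ((m + 1).factorial : ℚ_[p]), hrising, Nat.factorial_succ (2 * m)]
    push_cast
    linear_combination -(m.factorial : ℚ_[p]) ^ 4 * (3 * m + 2).factorial * (2 * m + 1) *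
      (2 * m).factorial * hsign

include hm in
theorem two_mul_dixon_quotient_congrMod :
    2 * (dixonNumerator ℚ_[p] m 0 / dixonDenominator ℚ_[p] m 0) ≡[p]
      (m.factorial : ℚ_[p]) ^ 4 := by
  have hdenom := norm_rising_mul_factorial_eq_one hm
  have hquot := ((dixonNumerator_zero_congrMod hm).mul_left (ofNat_mem 𝒪 2)).div
    (dixonDenominator_zero_congrMod hm)
    (norm_dixonDenominator_eq_one hm (.refl (zero_mem 𝒪))) hdenom
  have hfact := (two_mul_factorial_congrMod hm).mul_right (inv_mem_of_norm_eq_one hdenom)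
  rw [mul_inv_cancel_right₀ (ne_zero_of_norm_eq_one hdenom), ← div_eq_mul_inv] at hfact
  rw [← mul_div_assoc]
  exact hquot.trans hfact

include hm in
theorem padicGamma_quarter_pow_four_congrMod_factorial (h3 : 3 < p) :
    (padicGamma p (padicQuarter p h3) : ℚ_[p]) ^ 4 ≡[p] (m.factorial : ℚ_[p]) ^ 4 := by
  have hp := natCast_mem 𝒪 p
  have hwilson : ((p - 1).factorial : ℚ_[p]) ^ (4 * (3 * m + 2)) ≡[p] 1 := by
    have h := (wilson_congrMod (p := p)).pow (4 * (3 * m + 2))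
    rwa [Even.neg_one_pow ⟨2 * (3 * m + 2), by ring⟩] at h
  have hrising := (CongrMod.add_mul_self (one_mem 𝒪) hp (natCast_mem 𝒪 (3 * m + 2))).rising m
  have h := hwilson.mul (hrising.pow 4)
  rw [rising_one, one_mul] at h
  exact (padicGamma_quarter_pow_four_congrMod h3 (n := 2 * m + 1) (Q := 3 * m + 2) (R := m)
    (by omega) (by omega) (by rw [hm]; ring)).of_sq.trans h

include hm in
theorem dixon_quotient_congrMod :
    dixonNumerator ℚ_[p] m ((p : ℚ_[p]) ^ 2) / dixonDenominator ℚ_[p] m ((p : ℚ_[p]) ^ 2)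
      ≡[(p : ℚ_[p]) ^ 2] dixonNumerator ℚ_[p] m 0 / dixonDenominator ℚ_[p] m 0 := by
  have hzero : (p : ℚ_[p]) ^ 2 ≡[(p : ℚ_[p]) ^ 2] 0 := by
    simpa using CongrMod.add_mul_self (zero_mem 𝒪) (pow_mem (natCast_mem 𝒪 p) 2) (one_mem 𝒪)
  exact (dixonNumerator_congrMod hm hzero).div (dixonDenominator_congrMod hm hzero)
    (norm_dixonDenominator_eq_one hm hzero.of_sq)
    (norm_dixonDenominator_eq_one hm (.refl (zero_mem 𝒪)))

include hm in
theorem dixon_sum_sub_eq :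
    ∑ k ∈ range (2 * m + 1 + 1), dixonTerm (1 / 2 + (p : ℚ_[p]) ^ 2)
          ((2 * m + 1 : ℕ) + 1 - (p : ℚ_[p]) ^ 2) (2 * m + 1) k
        - ∑ k ∈ range (2 * m + 1 + 1), dixonTerm (1 / 2 : ℚ_[p]) ((2 * m + 1 : ℕ) + 1) (2 * m + 1) k
      = (p : ℚ_[p]) ^ 2 * ((1 / 2 + p) * (-(1 / 4) + 3 / 2 * p) *
          (dixonNumerator ℚ_[p] m ((p : ℚ_[p]) ^ 2) / dixonDenominator ℚ_[p] m ((p : ℚ_[p]) ^ 2))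
        + 1 / 8 * (dixonNumerator ℚ_[p] m 0 / dixonDenominator ℚ_[p] m 0)) := by
  have hpm : (4 * m + 3 : ℚ_[p]) = p := by exact_mod_cast hm.symm
  have hshift := dixon_sum_half_add (K := ℚ_[p]) m (p ^ 2)
  have hzero := dixon_sum_half_add (K := ℚ_[p]) m 0
  rw [Nat.cast_pow] at hshift
  rw [Nat.cast_zero, add_zero, sub_zero] at hzero
  rw [hshift, hzero, hpm]
  ring

include hm in
theorem dixon_coefficient_congrMod :
    (1 / 2 + (p : ℚ_[p])) * (-(1 / 4) + 3 / 2 * p) ≡[(p : ℚ_[p]) ^ 2] -(1 / 8) + p * (1 / 2) := by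
  have hp := natCast_mem 𝒪 p
  have hhalf := one_half_mem (p := p) (by omega)
  have h := CongrMod.add_mul_self
    (add_mem (neg_mem (one_eighth_mem (by omega))) (mul_mem hp hhalf)) (pow_mem hp 2)
    (mul_mem (ofNat_mem 𝒪 3) hhalf)
  convert h using 1
  ring

include hm in
/-- Both sides of Dixon's identity are expanded to first order in the shift `x = p²`: the sum has
slope `-3 legendreSum H`, while the product carries the two factors `p / 2 + x` and
`-p / 4 + 3 x / 2`. -/
theorem neg_three_mul_legendreSum_congrMod :
    -3 * legendreSum ℚ_[p] (fieldHarmonic ℚ_[p] 1) (2 * m + 1) ≡[(p : ℚ_[p]) ^ 2]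
      p * (1 / 2 * (dixonNumerator ℚ_[p] m 0 / dixonDenominator ℚ_[p] m 0)) := by
  have hn : p = 2 * (2 * m + 1) + 1 := by omega
  have hdixon := dixon_sum_sub_congrMod hn ⟨m, rfl⟩
  rw [dixon_sum_sub_eq hm] at hdixon
  have hquot := dixon_quotient_congrMod hm
  set R₀ := dixonNumerator ℚ_[p] m 0 / dixonDenominator ℚ_[p] m 0
  set R₁ := dixonNumerator ℚ_[p] m ((p : ℚ_[p]) ^ 2) / dixonDenominator ℚ_[p] m ((p : ℚ_[p]) ^ 2)
  have hexpand := ((dixon_coefficient_congrMod hm).mul hquot).add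
    (.refl (mul_mem (one_eighth_mem (by omega)) hquot.right_mem))
  have hslope := CongrMod.of_scale (pow_ne_zero 2 (NeZero.ne (p : ℚ_[p]))) hexpand.left_mem
    (mul_mem (neg_mem (ofNat_mem 𝒪 3)) (binomialSum_congrMod hn 1).right_mem)
    (by rwa [sq ((p : ℚ_[p]) ^ 2)] at hdixon)
  convert hslope.symm.trans hexpand using 1
  ring

include hm in
theorem legendreSum_harmonic_one_odd_congrMod (h3 : 3 < p) :
    legendreSum ℚ_[p] (fieldHarmonic ℚ_[p] 1) (2 * m + 1) ≡[(p : ℚ_[p]) ^ 2]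
      -((p : ℚ_[p]) / 12) * (padicGamma p (padicQuarter p h3) : ℚ_[p]) ^ 4 := by
  have hthree : ‖(-3 : ℚ_[p])‖ = 1 := by
    rw [norm_neg]
    exact_mod_cast norm_natCast_eq_one (p := p) (j := 3) (by omega) h3
  have hgamma := (((two_mul_dixon_quotient_congrMod hm).trans
    (padicGamma_quarter_pow_four_congrMod_factorial hm h3).symm).mul_left
      (one_quarter_mem (by omega))).scale_self (natCast_mem 𝒪 p)
  rw [← mul_assoc (1 / 4 : ℚ_[p]) 2, show (1 / 4 * 2 : ℚ_[p]) = 1 / 2 by norm_num] at hgamma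
  refine .of_mul_left hthree ?_
  convert (neg_three_mul_legendreSum_congrMod hm).trans hgamma using 1
  ring

end PrimeEqFourMulAddThree

theorem legendreSum_harmonic_one_even_congrMod (h3 : 3 < p) {m : ℕ} (hm : p = 4 * m + 1) :
    legendreSum ℚ_[p] (fieldHarmonic ℚ_[p] 1) (2 * m) ≡[(p : ℚ_[p]) ^ 2]
      (padicGamma p (padicQuarter p h3) : ℚ_[p]) ^ 4 *
        ((2 * fermatQuotient p 2 - p * fermatQuotient p 2 ^ 2 : ℚ) : ℚ_[p]) := by
  have hharmonic := (fieldHarmonic_half h3 (show p = 2 * (2 * m) + 1 by omega)).neg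
  have h := (neg_centralRatio_sq_congrMod_padicGamma h3 hm).mul hharmonic
  rw [neg_mul_neg] at h
  rw [legendreSum_harmonic_one_even]
  convert h using 2
  push_cast
  ring

theorem legendreSum_harmonic_two_even_congrMod (h3 : 3 < p) {m : ℕ} (hm : p = 4 * m + 1) :
    legendreSum ℚ_[p] (fieldHarmonic ℚ_[p] 2) (2 * m) ≡[(p : ℚ_[p]) ^ 2]
      -(padicGamma p (padicQuarter p h3) : ℚ_[p]) ^ 4 *
        ((4 * eulerNumber (p - 3) - 2 * eulerNumber (2 * p - 4) : ℤ) : ℚ_[p]) := by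
  have heuler := alternating_inv_sq_congrMod h3 (show p = 2 * (2 * m) + 1 by omega) (even_two_mul m)
  have h := ((neg_centralRatio_sq_congrMod_padicGamma h3 hm).neg).mul heuler
  rw [neg_neg] at h
  rw [legendreSum_harmonic_two_even]
  exact_mod_cast h

theorem legendreSum_harmonic_two_odd_congrMod (h3 : 3 < p) {m : ℕ} (hm : p = 4 * m + 3) :
    legendreSum ℚ_[p] (fieldHarmonic ℚ_[p] 2) (2 * m + 1) ≡[(p : ℚ_[p]) ^ 2]
      -(1 / 4) * (padicGamma p (padicQuarter p h3) : ℚ_[p]) ^ 4 := by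
  have h := (odd_centralRatio_sq_congrMod_padicGamma h3 hm).mul_left
    (neg_mem (one_quarter_mem (by omega)))
  rwa [legendreSum_harmonic_two_odd,
    show ∀ d : ℚ_[p], -(1 / d ^ 2) = -(1 / 4) * (2 / d) ^ 2 by intro d; ring]

end Padic

theorem mainTheorem2 (p : ℕ) [Fact p.Prime] (h3 : 3 < p) :
    (p % 4 = 1 →
      PadicCongr p 2
        ((∑ k ∈ Finset.Icc 1 (p - 1),
          ((2 * k).choose k : ℚ) ^ 3 * genHarmonic 1 k / 64 ^ k : ℚ) : ℚ_[p])
        ((padicGamma p (padicQuarter p h3) : ℚ_[p]) ^ 4 *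
          ((2 * fermatQuotient p 2 - p * fermatQuotient p 2 ^ 2 : ℚ) : ℚ_[p]))) ∧
    (p % 4 = 3 →
      PadicCongr p 2
        ((∑ k ∈ Finset.Icc 1 (p - 1),
          ((2 * k).choose k : ℚ) ^ 3 * genHarmonic 1 k / 64 ^ k : ℚ) : ℚ_[p])
        (-((p : ℚ_[p]) / 12) * (padicGamma p (padicQuarter p h3) : ℚ_[p]) ^ 4)) ∧
    (p % 4 = 1 →
      PadicCongr p 2
        ((∑ k ∈ Finset.Icc 1 (p - 1),
          ((2 * k).choose k : ℚ) ^ 3 * genHarmonic 2 k / 64 ^ k : ℚ) : ℚ_[p])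
        (-(padicGamma p (padicQuarter p h3) : ℚ_[p]) ^ 4 *
          ((4 * eulerNumber (p - 3) - 2 * eulerNumber (2 * p - 4) : ℤ) : ℚ_[p]))) ∧
    (p % 4 = 3 →
      PadicCongr p 2
        ((∑ k ∈ Finset.Icc 1 (p - 1),
          ((2 * k).choose k : ℚ) ^ 3 * genHarmonic 2 k / 64 ^ k : ℚ) : ℚ_[p])
        (-(1 / 4) * (padicGamma p (padicQuarter p h3) : ℚ_[p]) ^ 4)) := by
  have hone (h : p % 4 = 1) : p = 4 * (p / 4) + 1 := by omega
  have hthree (h : p % 4 = 3) : p = 4 * (p / 4) + 3 := by omega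
  have heven (h : p % 4 = 1) : p = 2 * (2 * (p / 4)) + 1 := by omega
  have hodd (h : p % 4 = 3) : p = 2 * (2 * (p / 4) + 1) + 1 := by omega
  exact ⟨
    fun h => ((binomialSum_congrMod (heven h) 1).trans
      (legendreSum_harmonic_one_even_congrMod h3 (hone h))).padicCongr,
    fun h => ((binomialSum_congrMod (hodd h) 1).trans
      (legendreSum_harmonic_one_odd_congrMod (hthree h) h3)).padicCongr,
    fun h => ((binomialSum_congrMod (heven h) 2).trans
      (legendreSum_harmonic_two_even_congrMod h3 (hone h))).padicCongr,
    fun h => ((binomialSum_congrMod (hodd h) 2).trans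
      (legendreSum_harmonic_two_odd_congrMod h3 (hthree h))).padicCongr⟩
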